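/- Let $0<H<1/3$ and let $B=(B_t)_{t\ge 0}$ be a fractional Brownian motion with Hurst parameter $H$ on a probability space $(\Omega,\mathcal F,\mathbb P)$, i.e. a centered Gaussian process with almost surely continuous paths and covariance $\mathbb E[B_sB_t]=\tfrac12\left(s^{2H}+t^{2H}-|t-s|^{2H}\right)$. Let $p_\varepsilon(x)=(2\pi\varepsilon)^{-1/2}e^{-x^2/(2\varepsilon)}$. For $t>0$ and $\lambda\in\mathbb R$, let the local time $L_t(\lambda)$ of $B$ up to time $t$ at level $\lambda$ and its spatial derivative $L'_t(\lambda)$ be the limits in $L^2(\Omega)$, as $\varepsilon\downarrow 0$, $$L_t(\lambda)=\lim_{\varepsilon\downarrow0}\int_0^t p_\varepsilon(B_s-\lambda)\,ds,\qquad L'_t(\lambda)=\lim_{\varepsilon\downarrow0}\int_0^t \frac{\partial}{\partial\lambda}\,p_\varepsilon(B_s-\lambda)\,ds=-\lim_{\varepsilon\downarrow0}\int_0^t p_\varepsilon'(B_s-\lambda)\,ds .$$ Let $f:\mathbb R\to\mathbb R$ be a measurable function with $\int_{\mathbb R}|f(y)|(1+|y|^{1+\nu})\,dy<\infty$ for some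 $\nu>0$. Then, for every $t>0$ and $\lambda\in\mathbb R$, both limits $L_t(\lambda)$ and $L_t'(\lambda)$ exist, for every $n\in\mathbb N$ the integral $\int_0^t f(n^H(B_s-\lambda))\,ds$ is almost surely absolutely convergent, and, as $n\to\infty$, $$n^H\left(n^H\int_0^t f\big(n^H(B_s-\lambda)\big)\,ds-L_t(\lambda)\int_{\mathbb R}f(x)\,dx\right)\longrightarrow L'_t(\lambda)\int_{\mathbb R}y f(y)\,dy\qquad\text{in }L^2(\Omega).$$ -/

import Mathlib

open MeasureTheory ProbabilityTheory Filter Topology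
open scoped NNReal ENNReal

/-- `B = (B_t)_{t ≥ 0}` is a fractional Brownian motion with Hurst parameter `H` on `(Ω, P)`:
a centered Gaussian process with covariance `(s^{2H} + t^{2H} - |t - s|^{2H}) / 2` and
almost surely continuous paths. -/
structure IsFractionalBrownianMotion {Ω : Type*} [MeasurableSpace Ω]
    (H : ℝ) (B : ℝ≥0 → Ω → ℝ) (P : Measure Ω) : Prop where
  isGaussianProcess : IsGaussianProcess B P
  integral_eq_zero : ∀ t : ℝ≥0, ∫ ω, B t ω ∂P = 0
  covariance_eq : ∀ s t : ℝ≥0, ∫ ω, B s ω * B t ω ∂P =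
    1 / 2 * ((s : ℝ) ^ (2 * H) + (t : ℝ) ^ (2 * H) - |(t : ℝ) - (s : ℝ)| ^ (2 * H))
  continuous_paths : ∀ᵐ ω ∂P, Continuous (fun t : ℝ≥0 => B t ω)

/-- Convergence in `L²(Ω)` of the family `X` to `Y` along the filter `l`; square integrability
of the limit and, eventually, of the family is part of the notion. -/
def TendstoInL2 {Ω ι : Type*} [MeasurableSpace Ω] (P : Measure Ω)
    (X : ι → Ω → ℝ) (l : Filter ι) (Y : Ω → ℝ) : Prop :=
  (∀ᶠ i in l, MemLp (X i) 2 P) ∧ MemLp Y 2 P ∧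
    Tendsto (fun i => eLpNorm (fun ω => X i ω - Y ω) 2 P) l (𝓝 0)

/-- The heat kernel `p_ε(x)` of variance `ε > 0`. -/
noncomputable def heatKernel (ε x : ℝ) : ℝ :=
  (√(2 * Real.pi * ε))⁻¹ * Real.exp (-x ^ 2 / (2 * ε))

/-- The mollified local time `L_{t,ε}(lam) = ∫_0^t p_ε(B_s - lam) ds`. -/
noncomputable def approxLocalTime {Ω : Type*} (B : ℝ≥0 → Ω → ℝ) (t lam ε : ℝ) (ω : Ω) : ℝ :=
  ∫ s in (0 : ℝ)..t, heatKernel ε (B s.toNNReal ω - lam)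

/-- The spatial derivative of the mollified local time,
`L'_{t,ε}(lam) = ∫_0^t (∂/∂lam) p_ε(B_s - lam) ds`. -/
noncomputable def approxLocalTimeDeriv {Ω : Type*} (B : ℝ≥0 → Ω → ℝ) (t lam ε : ℝ) (ω : Ω) : ℝ :=
  ∫ s in (0 : ℝ)..t, deriv (fun x : ℝ => heatKernel ε (B s.toNNReal ω - x)) lam

/-- `L` is (a version of) the local time `L_t(lam)` of `B` up to time `t` at level `lam`:
the `L²(Ω)`-limit of the mollified local times as `ε ↓ 0`. -/
def IsLocalTime {Ω : Type*} [MeasurableSpace Ω] (B : ℝ≥0 → Ω → ℝ) (P : Measure Ω)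
    (t lam : ℝ) (L : Ω → ℝ) : Prop :=
  TendstoInL2 P (approxLocalTime B t lam) (𝓝[>] (0 : ℝ)) L

/-- `L'` is (a version of) the spatial derivative `L'_t(lam)` of the local time of `B`:
the `L²(Ω)`-limit of the spatial derivatives of the mollified local times as `ε ↓ 0`. -/
def IsLocalTimeDeriv {Ω : Type*} [MeasurableSpace Ω] (B : ℝ≥0 → Ω → ℝ) (P : Measure Ω)
    (t lam : ℝ) (L' : Ω → ℝ) : Prop :=
  TendstoInL2 P (approxLocalTimeDeriv B t lam) (𝓝[>] (0 : ℝ)) L'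

/-!
The integral of `g` along the path of fractional Brownian motion `B` up to time `t` is
`I(g) = ∫_0^t g(B_s) ds` (`additiveFunctional`). Its second moments are
`E[I(g) I(h)] = ∬ g(x) h(y) Q(x, y)`, where `Q` is the joint density of `(B_s, B_r)` integrated over
the times `(s, r) ∈ (0, t]²`. When the primitives `G₁`, `G₂` of `g`, `h` are integrable,
integrating by parts in `x` and `y` gives `E[I(g) I(h)] = ∬ G₁(x) G₂(y) K(x, y)`, where `K` is the
time integral of the mixed derivative of the joint density
(`HasFBMPairLaw.integral_mul_eq_localTimeDerivKernel`). The determinant `Δ` of the covariance of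
`(B_s, B_r)` is at least a constant times `(min(s, r) |r - s|)^{2H}` by Heron's formula for the
triangle with sides `s^H`, `r^H`, `|r - s|^H` (`fbmDet_ge`), and the mixed derivative is
at most a constant times `(s r)^H Δ^{-3/2}`, hence at most a constant times
`(s^{-2H} + r^{-2H}) |r - s|^{-3H}` (`fbmDensity_bounds`). The latter is integrable because
`3 H < 1`, so `Q` and `K` are bounded and continuous.

The mollified local times are `I(p_ε(· - λ))` and the mollified derivatives are `-I(p_ε'(· - λ))`,
the primitive of `p_ε'` being `p_ε`. As `ε, δ ↓ 0` their second moments converge to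
`Q(λ, λ)` and `K(λ, λ)` respectively, since `p_ε(· - λ)` concentrates at `λ`; convergence of second
moments gives convergence in `L²` (`exists_tendstoInL2`).

For the limit theorem put `m = n^H`, `c = ∫ f`, `c₁ = ∫ y f(y) dy` and
`g = f - c p_δ + c₁ p_1'` with `δ ∈ (0, 1]`. This `g` satisfies `∫ g = ∫ y g(y) dy = 0`, so its
primitive `G` is integrable with `∫ G = 0`, and `G` is dominated by the tails of `|g|`, uniformly
in `δ`. By scaling, `I(m² g(m(· - λ)))` is
`m (m ∫_0^t f(m (B_s - λ)) ds - c L_{t, δ/m²}(λ)) - c₁ L'_{t, 1/m²}(λ)`, and its second moment is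
`∬ G(x) G(y) K(λ + x/m, λ + y/m)`, which tends to `(∫ G)² K(λ, λ) = 0` by dominated convergence
(`HasFBMPairLaw.tendsto_eLpNorm_scale`). It remains to choose `δ`, depending on `n`, so small that
`m (L_{t, δ/m²}(λ) - L_t(λ))` is negligible.
-/

/-! ### Calculus of the heat kernel -/

/-- The first derivative `p_v'` of the heat kernel in the space variable. -/
noncomputable def heatKernelDeriv (v x : ℝ) : ℝ := -(x / v) * heatKernel v x

/-- The second derivative `p_v''` of the heat kernel in the space variable. -/
noncomputable def heatKernelDeriv₂ (v x : ℝ) : ℝ := (x ^ 2 / v ^ 2 - 1 / v) * heatKernel v x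

lemma heatKernel_pos {v : ℝ} (hv : 0 < v) (x : ℝ) : 0 < heatKernel v x := by
  unfold heatKernel; positivity

lemma heatKernel_neg (v x : ℝ) : heatKernel v (-x) = heatKernel v x := by simp [heatKernel]

lemma heatKernel_eq_gaussianPDFReal (v : ℝ≥0) : heatKernel v = gaussianPDFReal 0 v := by
  ext x; simp [heatKernel, gaussianPDFReal]

lemma integrable_heatKernel {v : ℝ} (hv : 0 < v) : Integrable (heatKernel v) := by
  lift v to ℝ≥0 using hv.le
  rw [heatKernel_eq_gaussianPDFReal]
  exact integrable_gaussianPDFReal 0 v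

lemma integral_heatKernel {v : ℝ} (hv : 0 < v) : ∫ x, heatKernel v x = 1 := by
  lift v to ℝ≥0 using hv.le
  rw [heatKernel_eq_gaussianPDFReal]
  exact integral_gaussianPDFReal_eq_one 0 (by exact_mod_cast hv.ne')

lemma measurable_heatKernel_uncurry : Measurable (fun p : ℝ × ℝ => heatKernel p.1 p.2) := by
  unfold heatKernel; fun_prop

lemma measurable_heatKernelDeriv_uncurry :
    Measurable (fun p : ℝ × ℝ => heatKernelDeriv p.1 p.2) := by
  unfold heatKernelDeriv heatKernel; fun_prop

lemma measurable_heatKernelDeriv₂_uncurry :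
    Measurable (fun p : ℝ × ℝ => heatKernelDeriv₂ p.1 p.2) := by
  unfold heatKernelDeriv₂ heatKernel; fun_prop

lemma continuous_heatKernel (v : ℝ) : Continuous (heatKernel v) := by
  unfold heatKernel; fun_prop

lemma continuous_heatKernelDeriv (v : ℝ) : Continuous (heatKernelDeriv v) := by
  unfold heatKernelDeriv heatKernel; fun_prop

lemma continuous_heatKernelDeriv₂ (v : ℝ) : Continuous (heatKernelDeriv₂ v) := by
  unfold heatKernelDeriv₂ heatKernel; fun_prop

lemma hasDerivAt_heatKernel {v : ℝ} (hv : 0 < v) (x : ℝ) :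
    HasDerivAt (heatKernel v) (heatKernelDeriv v x) x := by
  have h : HasDerivAt (fun x : ℝ => -x ^ 2 / (2 * v)) (-(x / v)) x := by
    have := ((hasDerivAt_pow 2 x).neg).div_const (2 * v)
    refine this.congr_deriv ?_
    field_simp
    norm_num
  have := (h.exp).const_mul (√(2 * Real.pi * v))⁻¹
  refine this.congr_deriv ?_
  unfold heatKernelDeriv heatKernel
  ring

lemma hasDerivAt_heatKernelDeriv {v : ℝ} (hv : 0 < v) (x : ℝ) :
    HasDerivAt (heatKernelDeriv v) (heatKernelDeriv₂ v x) x := by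
  have h : HasDerivAt (fun x : ℝ => -(x / v)) (-(1 / v)) x :=
    ((hasDerivAt_id x).div_const v).neg
  refine (h.mul (hasDerivAt_heatKernel hv x)).congr_deriv ?_
  unfold heatKernelDeriv₂ heatKernelDeriv
  ring

/-- Brownian scaling of the heat kernel. -/
lemma heatKernel_scale {m : ℝ} (hm : 0 < m) {v : ℝ} (x : ℝ) :
    heatKernel (v / m ^ 2) x = m * heatKernel v (m * x) := by
  unfold heatKernel
  have h1 : √(2 * Real.pi * (v / m ^ 2)) = √(2 * Real.pi * v) / m := by
    rw [← mul_div_assoc, Real.sqrt_div' _ (by positivity), Real.sqrt_sq hm.le]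
  rw [h1, inv_div, show -x ^ 2 / (2 * (v / m ^ 2)) = -(m * x) ^ 2 / (2 * v) by
    field_simp]
  ring

lemma heatKernelDeriv_scale {m : ℝ} (hm : 0 < m) {v : ℝ} (x : ℝ) :
    heatKernelDeriv (v / m ^ 2) x = m ^ 2 * heatKernelDeriv v (m * x) := by
  unfold heatKernelDeriv
  rw [heatKernel_scale hm]
  field_simp

lemma heatKernel_one_bounds (z : ℝ) :
    heatKernel 1 z ≤ 1 ∧ |z| * heatKernel 1 z ≤ 1 ∧ z ^ 2 * heatKernel 1 z ≤ 1 := by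
  have hp : (√(2 * Real.pi * 1))⁻¹ ≤ 1 / 2 := by
    have h4 : (2 : ℝ) ≤ √(2 * Real.pi * 1) := by
      apply Real.le_sqrt_of_sq_le
      nlinarith [Real.pi_gt_three]
    rw [one_div]
    exact inv_anti₀ (by norm_num) h4
  have he : Real.exp (-z ^ 2 / (2 * 1)) * (1 + z ^ 2 / 2) ≤ 1 := by
    have h1 := Real.add_one_le_exp (z ^ 2 / 2)
    have h2 : Real.exp (-z ^ 2 / (2 * 1)) * Real.exp (z ^ 2 / 2) = 1 := by
      rw [← Real.exp_add]; simp; ring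
    calc _ ≤ Real.exp (-z ^ 2 / (2 * 1)) * Real.exp (z ^ 2 / 2) := by gcongr; linarith
      _ = 1 := h2
  have hk : heatKernel 1 z * (2 + z ^ 2) ≤ 1 := by
    unfold heatKernel
    have : 0 < Real.exp (-z ^ 2 / (2 * 1)) := Real.exp_pos _
    calc _ = (√(2 * Real.pi * 1))⁻¹ * 2 * (Real.exp (-z ^ 2 / (2 * 1)) * (1 + z ^ 2 / 2)) := by ring
      _ ≤ 1 / 2 * 2 * 1 := by gcongr
      _ = 1 := by norm_num
  have hpos := heatKernel_pos one_pos z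
  refine ⟨by nlinarith [mul_nonneg hpos.le (sq_nonneg z)], ?_, by nlinarith⟩
  have : |z| ≤ 2 + z ^ 2 := by nlinarith [sq_abs z, sq_nonneg (|z| - 1)]
  nlinarith

lemma heatKernel_eq_scale_one {v : ℝ} (hv : 0 < v) (x : ℝ) :
    heatKernel v x = (√v)⁻¹ * heatKernel 1 ((√v)⁻¹ * x) := by
  rw [← heatKernel_scale (inv_pos.2 (Real.sqrt_pos.2 hv)), inv_pow, Real.sq_sqrt hv.le,
    one_div, inv_inv]

lemma abs_heatKernel_le {v : ℝ} (hv : 0 < v) (x : ℝ) : |heatKernel v x| ≤ (√v)⁻¹ := by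
  rw [abs_of_pos (heatKernel_pos hv x), heatKernel_eq_scale_one hv]
  exact mul_le_of_le_one_right (by positivity) (heatKernel_one_bounds _).1

lemma abs_heatKernelDeriv_le {v : ℝ} (hv : 0 < v) (x : ℝ) :
    |heatKernelDeriv v x| ≤ v⁻¹ := by
  have hs := Real.sqrt_pos.2 hv
  have h := (heatKernel_one_bounds ((√v)⁻¹ * x)).2.1
  unfold heatKernelDeriv
  rw [abs_mul, abs_of_pos (heatKernel_pos hv x), heatKernel_eq_scale_one hv, abs_neg, abs_div,
    abs_of_pos hv]
  rw [abs_mul, abs_of_pos (inv_pos.2 hs)] at h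
  calc _ = v⁻¹ * ((√v)⁻¹ * |x| * heatKernel 1 ((√v)⁻¹ * x)) := by ring
    _ ≤ v⁻¹ * 1 := by gcongr
    _ = v⁻¹ := mul_one _

lemma abs_heatKernelDeriv₂_le {v : ℝ} (hv : 0 < v) (x : ℝ) :
    |heatKernelDeriv₂ v x| ≤ 2 * (v * √v)⁻¹ := by
  have hs := Real.sqrt_pos.2 hv
  obtain ⟨h0, -, h⟩ := heatKernel_one_bounds ((√v)⁻¹ * x)
  have hp := (heatKernel_pos one_pos ((√v)⁻¹ * x)).le
  have e : heatKernelDeriv₂ v x = (v * √v)⁻¹ * (((√v)⁻¹ * x) ^ 2 * heatKernel 1 ((√v)⁻¹ * x)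
      - heatKernel 1 ((√v)⁻¹ * x)) := by
    unfold heatKernelDeriv₂
    rw [heatKernel_eq_scale_one hv, mul_pow, inv_pow, Real.sq_sqrt hv.le]
    field_simp
  rw [e, abs_mul, abs_of_pos (by positivity), mul_comm]
  gcongr
  rw [abs_le]
  constructor <;> nlinarith [mul_nonneg (sq_nonneg ((√v)⁻¹ * x)) hp]

lemma integrable_pow_mul_heatKernel {v : ℝ} (hv : 0 < v) (k : ℕ) :
    Integrable (fun x => x ^ k * heatKernel v x) := by
  have h := (integrable_rpow_mul_exp_neg_mul_sq (b := (2 * v)⁻¹) (by positivity)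
    (s := k) (by linarith [(Nat.cast_nonneg k : (0 : ℝ) ≤ k)])).const_mul (√(2 * Real.pi * v))⁻¹
  refine h.congr (Eventually.of_forall fun x => ?_)
  simp only [heatKernel, Real.rpow_natCast]
  rw [show -x ^ 2 / (2 * v) = -(2 * v)⁻¹ * x ^ 2 by rw [div_eq_inv_mul]; ring]
  ring

lemma integrable_heatKernelDeriv {v : ℝ} (hv : 0 < v) : Integrable (heatKernelDeriv v) := by
  refine ((integrable_pow_mul_heatKernel hv 1).const_mul (-(1 / v))).congr
    (Eventually.of_forall fun x => ?_)
  simp only [heatKernelDeriv]; ring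

lemma tendsto_heatKernel_cocompact {v : ℝ} (hv : 0 < v) :
    Tendsto (heatKernel v) (cocompact ℝ) (𝓝 0) := by
  have h := (Real.tendsto_exp_neg_atTop_nhds_zero.comp
    ((tendsto_pow_atTop two_ne_zero).comp (tendsto_norm_cocompact_atTop (E := ℝ)) |>.atTop_mul_const
      (r := (2 * v)⁻¹) (by positivity))).const_mul (√(2 * Real.pi * v))⁻¹
  rw [mul_zero] at h
  refine h.congr fun x => ?_
  simp only [heatKernel, Function.comp, Real.norm_eq_abs, sq_abs]
  rw [div_eq_mul_inv, neg_mul]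

/-! ### The joint density of a Gaussian pair -/

/-- The density of a centred Gaussian pair `(X, Y)` with `Var X = v`, `Cov (X, Y) = γ` and
`Var Y = u`, written as the density of `X` times the conditional density of `Y` given `X`. -/
noncomputable def pairDensity (v γ u x y : ℝ) : ℝ :=
  heatKernel v x * heatKernel (u - γ ^ 2 / v) (y - γ / v * x)

/-- The derivative `∂_y` of `pairDensity v γ u x y`. -/
noncomputable def pairDensityDeriv (v γ u x y : ℝ) : ℝ :=
  heatKernel v x * heatKernelDeriv (u - γ ^ 2 / v) (y - γ / v * x)

/-- The mixed derivative `∂_x ∂_y` of `pairDensity v γ u x y`. -/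
noncomputable def pairDensityMixed (v γ u x y : ℝ) : ℝ :=
  heatKernelDeriv v x * heatKernelDeriv (u - γ ^ 2 / v) (y - γ / v * x)
    - γ / v * (heatKernel v x * heatKernelDeriv₂ (u - γ ^ 2 / v) (y - γ / v * x))

section PairDensity

variable {v γ u : ℝ}

lemma condVar_pos (hv : 0 < v) (hΔ : 0 < v * u - γ ^ 2) : 0 < u - γ ^ 2 / v := by
  have : u - γ ^ 2 / v = (v * u - γ ^ 2) / v := by field_simp
  rw [this]; positivity

lemma mul_condVar (hv : 0 < v) : v * (u - γ ^ 2 / v) = v * u - γ ^ 2 := by field_simp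

lemma pairDensity_nonneg (hv : 0 < v) (hΔ : 0 < v * u - γ ^ 2) (x y : ℝ) :
    0 ≤ pairDensity v γ u x y :=
  mul_nonneg (heatKernel_pos hv _).le (heatKernel_pos (condVar_pos hv hΔ) _).le

lemma abs_pairDensity_le (hv : 0 < v) (hΔ : 0 < v * u - γ ^ 2) (x y : ℝ) :
    |pairDensity v γ u x y| ≤ (√(v * u - γ ^ 2))⁻¹ := by
  have hw := condVar_pos hv hΔ
  rw [pairDensity, abs_mul, ← mul_condVar hv, Real.sqrt_mul hv.le, mul_inv]
  exact mul_le_mul (abs_heatKernel_le hv _) (abs_heatKernel_le hw _) (abs_nonneg _) (by positivity)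

lemma abs_pairDensityMixed_le (hv : 0 < v) (hΔ : 0 < v * u - γ ^ 2) (x y : ℝ) :
    |pairDensityMixed v γ u x y| ≤ (v * u - γ ^ 2)⁻¹
      + 2 * |γ| * ((v * u - γ ^ 2) * √(v * u - γ ^ 2))⁻¹ := by
  have hw := condVar_pos hv hΔ
  rw [← mul_condVar hv, Real.sqrt_mul hv.le]
  set w := u - γ ^ 2 / v
  have hsv := Real.sqrt_pos.2 hv
  have hsw := Real.sqrt_pos.2 hw
  calc _ ≤ |heatKernelDeriv v x * heatKernelDeriv w (y - γ / v * x)|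
        + |γ / v * (heatKernel v x * heatKernelDeriv₂ w (y - γ / v * x))| := abs_sub _ _
    _ = |heatKernelDeriv v x| * |heatKernelDeriv w (y - γ / v * x)|
        + |γ| / v * (|heatKernel v x| * |heatKernelDeriv₂ w (y - γ / v * x)|) := by
      simp only [abs_mul, abs_div, abs_of_pos hv]
    _ ≤ v⁻¹ * w⁻¹ + |γ| / v * ((√v)⁻¹ * (2 * (w * √w)⁻¹)) := by
      gcongr
      · exact abs_heatKernelDeriv_le hv _
      · exact abs_heatKernelDeriv_le hw _
      · exact abs_heatKernel_le hv _
      · exact abs_heatKernelDeriv₂_le hw _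
    _ = _ := by field_simp

lemma continuous_pairDensity (v γ u : ℝ) :
    Continuous (fun p : ℝ × ℝ => pairDensity v γ u p.1 p.2) := by
  unfold pairDensity
  exact ((continuous_heatKernel _).comp (by fun_prop)).mul
    ((continuous_heatKernel _).comp (by fun_prop))

lemma continuous_pairDensityDeriv (v γ u : ℝ) :
    Continuous (fun p : ℝ × ℝ => pairDensityDeriv v γ u p.1 p.2) := by
  unfold pairDensityDeriv
  exact ((continuous_heatKernel _).comp (by fun_prop)).mul
    ((continuous_heatKernelDeriv _).comp (by fun_prop))

lemma continuous_pairDensityMixed (v γ u : ℝ) :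
    Continuous (fun p : ℝ × ℝ => pairDensityMixed v γ u p.1 p.2) := by
  unfold pairDensityMixed
  exact (((continuous_heatKernelDeriv _).comp (by fun_prop)).mul
    ((continuous_heatKernelDeriv _).comp (by fun_prop))).sub (continuous_const.mul
    (((continuous_heatKernel _).comp (by fun_prop)).mul
    ((continuous_heatKernelDeriv₂ _).comp (by fun_prop))))

/-- The density of a pair of centred, jointly Gaussian variables with invertible covariance matrix:
`Y - (γ / v) X` is independent of `X` with variance `u - γ² / v`. -/
lemma map_pair_eq_withDensity {Ω : Type*} [MeasurableSpace Ω] {P : Measure Ω}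
    [IsProbabilityMeasure P] {X Y : Ω → ℝ} (hXY : HasGaussianLaw (fun ω => (X ω, Y ω)) P)
    (hX0 : ∫ ω, X ω ∂P = 0) (hY0 : ∫ ω, Y ω ∂P = 0) (hXX : ∫ ω, X ω * X ω ∂P = v)
    (hXYc : ∫ ω, X ω * Y ω ∂P = γ) (hYY : ∫ ω, Y ω * Y ω ∂P = u)
    (hv : 0 < v) (hΔ : 0 < v * u - γ ^ 2) :
    P.map (fun ω => (X ω, Y ω)) =
      (volume : Measure (ℝ × ℝ)).withDensity
        (fun p => ENNReal.ofReal (pairDensity v γ u p.1 p.2)) := by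
  have hw := condVar_pos hv hΔ
  set w := u - γ ^ 2 / v with hwdef
  set ρ := γ / v with hρ
  set Z : Ω → ℝ := fun ω => Y ω - ρ * X ω with hZ
  have hXl := hXY.fst
  have hYl := hXY.snd
  have hXm : MemLp X 2 P := hXl.memLp_two
  have hYm : MemLp Y 2 P := hYl.memLp_two
  have hXZ : HasGaussianLaw (fun ω => (X ω, Z ω)) P := by
    have := hXY.map_fun ((ContinuousLinearMap.fst ℝ ℝ ℝ).prod
      (ContinuousLinearMap.snd ℝ ℝ ℝ - ρ • ContinuousLinearMap.fst ℝ ℝ ℝ))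
    simpa using this
  have hZl := hXZ.snd
  have hXmeas := hXl.aemeasurable
  have hZmeas := hZl.aemeasurable
  have hZ0 : ∫ ω, Z ω ∂P = 0 := by
    simp only [hZ]
    rw [integral_sub hYl.integrable (hXl.integrable.const_mul _), integral_const_mul, hX0, hY0]
    simp
  have iXX : Integrable (fun ω => X ω * X ω) P := hXm.integrable_mul hXm
  have iXY : Integrable (fun ω => X ω * Y ω) P := hXm.integrable_mul hYm
  have iYY : Integrable (fun ω => Y ω * Y ω) P := hYm.integrable_mul hYm
  have hcov : cov[X, Z; P] = 0 := by
    rw [covariance_eq_sub hXm hZl.memLp_two, hX0, zero_mul, sub_zero]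
    have : (X * Z) = fun ω => X ω * Y ω - ρ * (X ω * X ω) := by
      ext ω; simp only [hZ, Pi.mul_apply]; ring
    rw [this, integral_sub iXY (iXX.const_mul _), integral_const_mul, hXX, hXYc, hρ]
    field_simp
    ring
  have hvarX : Var[X; P] = v := by
    rw [variance_eq_sub hXm, hX0]
    simp only [Pi.pow_apply]
    simp_rw [pow_two, hXX]; simp
  have hvarZ : Var[Z; P] = w := by
    rw [variance_eq_sub hZl.memLp_two, hZ0]
    have : (Z ^ 2) = fun ω => Y ω * Y ω - (2 * ρ * (X ω * Y ω) - ρ ^ 2 * (X ω * X ω)) := by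
      ext ω; simp only [hZ, Pi.pow_apply]; ring
    have i2 : Integrable (fun ω => 2 * ρ * (X ω * Y ω) - ρ ^ 2 * (X ω * X ω)) P :=
      (iXY.const_mul _).sub (iXX.const_mul _)
    rw [this, integral_sub iYY i2,
      integral_sub (iXY.const_mul _) (iXX.const_mul _), integral_const_mul, integral_const_mul,
      hXX, hXYc, hYY, hρ, hwdef]
    field_simp
    ring
  have law : ∀ {V : Ω → ℝ} {z : ℝ}, HasGaussianLaw V P → ∫ ω, V ω ∂P = 0 → Var[V; P] = z →
      0 < z → P.map V = volume.withDensity (fun x => ENNReal.ofReal (heatKernel z x)) := by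
    intro V z hV h0 hvar hz
    rw [hV.map_eq_gaussianReal, h0, hvar, gaussianReal_of_var_ne_zero _ (by simpa using hz)]
    congr 1
    ext x
    rw [gaussianPDF, ← heatKernel_eq_gaussianPDFReal, Real.coe_toNNReal _ hz.le]
  have hindep := hXZ.indepFun_of_covariance_eq_zero hcov
  have hmap := (indepFun_iff_map_prod_eq_prod_map_map hXmeas hZmeas).1 hindep
  have mk : ∀ z, Measurable (fun x => ENNReal.ofReal (heatKernel z x)) := fun z =>
    (continuous_heatKernel z).measurable.ennreal_ofReal
  rw [law hXl hX0 hvarX hv, law hZl hZ0 hvarZ hw, prod_withDensity (mk v) (mk w)] at hmap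
  have mq : Measurable (fun p : ℝ × ℝ => ENNReal.ofReal (pairDensity v γ u p.1 p.2)) :=
    (continuous_pairDensity v γ u).measurable.ennreal_ofReal
  have mvw : Measurable (fun p : ℝ × ℝ =>
      ENNReal.ofReal (heatKernel v p.1) * ENNReal.ofReal (heatKernel w p.2)) :=
    ((mk v).comp measurable_fst).mul ((mk w).comp measurable_snd)
  refine Measure.ext_of_lintegral _ fun F hF => ?_
  have hsh : Measurable (fun p : ℝ × ℝ => (p.1, p.2 + ρ * p.1)) := by fun_prop
  have hFs : Measurable (fun p : ℝ × ℝ => F (p.1, p.2 + ρ * p.1)) := hF.comp hsh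
  have e1 : P.map (fun ω => (X ω, Y ω)) =
      (P.map (fun ω => (X ω, Z ω))).map (fun p : ℝ × ℝ => (p.1, p.2 + ρ * p.1)) := by
    rw [AEMeasurable.map_map_of_aemeasurable hsh.aemeasurable (hXmeas.prodMk hZmeas)]
    congr 1
    ext ω <;> simp [hZ]
  rw [e1, lintegral_map hF hsh, hmap, lintegral_withDensity_eq_lintegral_mul _ mvw
      (g := fun p => F (p.1, p.2 + ρ * p.1)) hFs,
    lintegral_withDensity_eq_lintegral_mul _ mq hF]
  rw [lintegral_prod _ (mvw.mul hFs).aemeasurable, Measure.volume_eq_prod,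
    lintegral_prod _ (mq.mul hF).aemeasurable]
  refine lintegral_congr fun x => ?_
  symm
  rw [← lintegral_add_right_eq_self (μ := volume) _ (ρ * x)]
  refine lintegral_congr fun z => ?_
  simp only [Pi.mul_apply, pairDensity]
  rw [ENNReal.ofReal_mul (heatKernel_pos hv _).le, ← hwdef, ← hρ, add_sub_cancel_right]

end PairDensity

/-! ### The covariance of fractional Brownian motion -/

/-- The covariance of fractional Brownian motion at the times `s` and `r`. -/
noncomputable def fbmCov (H s r : ℝ) : ℝ :=
  1 / 2 * (s ^ (2 * H) + r ^ (2 * H) - |r - s| ^ (2 * H))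

lemma fbmCov_comm (H s r : ℝ) : fbmCov H s r = fbmCov H r s := by
  unfold fbmCov; rw [abs_sub_comm]; ring

/-- The determinant of the covariance matrix of fractional Brownian motion at `s` and `r`. -/
noncomputable def fbmDet (H s r : ℝ) : ℝ := s ^ (2 * H) * r ^ (2 * H) - fbmCov H s r ^ 2

lemma fbmDet_comm (H s r : ℝ) : fbmDet H s r = fbmDet H r s := by
  unfold fbmDet; rw [fbmCov_comm, mul_comm]

/-- A quantitative form of the strict subadditivity of `x ↦ x ^ H`. -/
lemma add_rpow_le_sub_min {H s d : ℝ} (hH0 : 0 < H) (hH1 : H < 1) (hs : 0 < s) (hd : 0 < d) :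
    (s + d) ^ H ≤ s ^ H + d ^ H - (1 - H) * min (s ^ H) (d ^ H) := by
  wlog h : d ≤ s generalizing s d
  · have := this hd hs (le_of_not_ge h)
    rw [add_comm, min_comm] at this
    linarith
  have hmin : min (s ^ H) (d ^ H) = d ^ H := min_eq_right (Real.rpow_le_rpow hd.le h hH0.le)
  rw [hmin]
  have e1 : (s + d) ^ H = s ^ H * (1 + d / s) ^ H := by
    rw [← Real.mul_rpow hs.le (by positivity)]; congr 1; field_simp
  have e2 : (1 + d / s) ^ H ≤ 1 + H * (d / s) :=
    rpow_one_add_le_one_add_mul_self (by have : 0 < d / s := by positivity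
                                         linarith) hH0.le hH1.le
  have e3 : d / s ≤ (d / s) ^ H := by
    conv_lhs => rw [← Real.rpow_one (d / s)]
    exact Real.rpow_le_rpow_of_exponent_ge (by positivity) ((div_le_one hs).2 h) hH1.le
  have e4 : s ^ H * (d / s) ^ H = d ^ H := by
    rw [← Real.mul_rpow hs.le (by positivity)]; congr 1; field_simp
  have hsH : 0 < s ^ H := by positivity
  calc (s + d) ^ H ≤ s ^ H * (1 + H * (d / s) ^ H) := by
        rw [e1]; gcongr; exact e2.trans (by gcongr)
    _ = s ^ H + H * (s ^ H * (d / s) ^ H) := by ring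
    _ = _ := by rw [e4]; ring

lemma rpow_two_mul {H s : ℝ} (hs : 0 ≤ s) : s ^ (2 * H) = (s ^ H) ^ 2 := by
  rw [mul_comm, Real.rpow_mul hs, Real.rpow_two]

/-- Local nondeterminism of fractional Brownian motion at two times: `s ^ H`, `r ^ H` and
`|r - s| ^ H` are the sides of a triangle, and by Heron's formula the determinant is four times
the square of its area. -/
lemma fbmDet_ge_of_lt {H s r : ℝ} (hH0 : 0 < H) (hH1 : H < 1) (hs : 0 < s) (hsr : s < r) :
    (1 - H) / 4 * (s ^ H * |r - s| ^ H) ^ 2 ≤ fbmDet H s r := by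
  have hd : 0 < r - s := sub_pos.2 hsr
  have hr : 0 < r := hs.trans hsr
  have h := add_rpow_le_sub_min hH0 hH1 hs hd
  rw [add_sub_cancel] at h
  unfold fbmDet fbmCov
  rw [abs_of_pos hd, rpow_two_mul hs.le, rpow_two_mul hr.le, rpow_two_mul hd.le]
  have hab : s ^ H ≤ r ^ H := Real.rpow_le_rpow hs.le hsr.le hH0.le
  have hcb : (r - s) ^ H ≤ r ^ H := Real.rpow_le_rpow hd.le (by linarith) hH0.le
  have ha : 0 < s ^ H := by positivity
  have hc : 0 < (r - s) ^ H := by positivity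
  set a := s ^ H
  set b := r ^ H
  set c := (r - s) ^ H
  have hm : 0 < min a c := lt_min ha hc
  have h1H : 0 < 1 - H := by linarith
  calc (1 - H) / 4 * (a * c) ^ 2 = 1 / 4 * ((1 - H) * min a c) * c * a * max a c := by
        have := min_mul_max a c
        linear_combination (1 - H) / 4 * a * c * -this
    _ ≤ 1 / 4 * (a + c - b) * (c + b - a) * (a + b - c) * (a + b + c) := by
        have h1 : (1 - H) * min a c ≤ a + c - b := by linarith
        have h0 : 0 ≤ (1 - H) * min a c := by positivity
        have h2 : c ≤ c + b - a := by linarith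
        have h3 : a ≤ a + b - c := by linarith
        have h4 : max a c ≤ a + b + c := max_le (by linarith) (by linarith)
        have h5 : 0 ≤ a + c - b := h0.trans h1
        have h6 : 0 ≤ c + b - a := hc.le.trans h2
        have h7 : 0 ≤ a + b - c := ha.le.trans h3
        gcongr
    _ = _ := by ring

lemma fbmDet_ge {H s r : ℝ} (hH0 : 0 < H) (hH1 : H < 1) (hs : 0 < s) (hr : 0 < r)
    (hsr : s ≠ r) : (1 - H) / 4 * (min s r ^ H * |r - s| ^ H) ^ 2 ≤ fbmDet H s r := by
  rcases lt_or_gt_of_ne hsr with h | h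
  · rw [min_eq_left h.le]; exact fbmDet_ge_of_lt hH0 hH1 hs h
  · rw [min_eq_right h.le, abs_sub_comm, fbmDet_comm]; exact fbmDet_ge_of_lt hH0 hH1 hr h

lemma fbmDet_pos {H s r : ℝ} (hH0 : 0 < H) (hH1 : H < 1) (hs : 0 < s) (hr : 0 < r)
    (hsr : s ≠ r) : 0 < fbmDet H s r := by
  refine lt_of_lt_of_le ?_ (fbmDet_ge hH0 hH1 hs hr hsr)
  have : 0 < |r - s| := abs_pos.2 (sub_ne_zero.2 hsr.symm)
  have : 0 < min s r := lt_min hs hr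
  have : 0 < 1 - H := by linarith
  positivity

/-! ### Bounds on the joint density of fractional Brownian motion -/

/-- An upper bound, integrable over `(0, t]²` when `H < 1 / 3`, for the joint density of fractional
Brownian motion at the times `p.1`, `p.2` and for its mixed second derivative. -/
noncomputable def fbmMajorant (H : ℝ) (p : ℝ × ℝ) : ℝ :=
  (p.1 ^ (-(2 * H)) + p.2 ^ (-(2 * H))) * |p.2 - p.1| ^ (-(3 * H))

/-- Joint density at the levels `x`, `y` of fractional Brownian motion at the times `p.1`, `p.2`. -/
noncomputable def fbmDensity (H : ℝ) (p : ℝ × ℝ) (x y : ℝ) : ℝ :=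
  pairDensity (p.1 ^ (2 * H)) (fbmCov H p.1 p.2) (p.2 ^ (2 * H)) x y

/-- The mixed derivative `∂_x ∂_y` of `fbmDensity H p x y`. -/
noncomputable def fbmDensityMixed (H : ℝ) (p : ℝ × ℝ) (x y : ℝ) : ℝ :=
  pairDensityMixed (p.1 ^ (2 * H)) (fbmCov H p.1 p.2) (p.2 ^ (2 * H)) x y

/-- Both bounds come from the local nondeterminism estimate `fbmDet_ge`: with `D² = fbmDet H s r`
and `m = (min s r) ^ H`, the density is at most `1 / D` and its mixed derivative at most a multiple
of `m t ^ H / D³`. -/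
lemma fbmDensity_bounds {H t : ℝ} (hH0 : 0 < H) (hH1 : H < 1) (ht : 0 < t) :
    ∃ C : ℝ, ∀ p : ℝ × ℝ, p.1 ∈ Set.Ioc 0 t → p.2 ∈ Set.Ioc 0 t → p.1 ≠ p.2 → ∀ x y : ℝ,
      |fbmDensity H p x y| ≤ C * fbmMajorant H p ∧
      |fbmDensityMixed H p x y| ≤ C * fbmMajorant H p := by
  set T := t ^ H with hT
  set κ := √((1 - H) / 4) with hκ
  have hκ0 : 0 < κ := Real.sqrt_pos.2 (by linarith)
  have hT0 : 0 < T := by positivity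
  refine ⟨(3 * T + T ^ 3) / κ ^ 3, ?_⟩
  rintro ⟨s, r⟩ ⟨hs, hst⟩ ⟨hr, hrt⟩ hsr x y
  simp only at hs hst hr hrt hsr
  have hmin : 0 < min s r := lt_min hs hr
  have hd : 0 < |r - s| := abs_pos.2 (sub_ne_zero.2 hsr.symm)
  have hΔ := fbmDet_pos hH0 hH1 hs hr hsr
  have hge := fbmDet_ge hH0 hH1 hs hr hsr
  have hv : 0 < s ^ (2 * H) := by positivity
  have hq := abs_pairDensity_le hv hΔ x y
  have hk := abs_pairDensityMixed_le hv hΔ x y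
  change _ ≤ (√(fbmDet H s r))⁻¹ at hq
  change _ ≤ (fbmDet H s r)⁻¹ + 2 * _ * (fbmDet H s r * √(fbmDet H s r))⁻¹ at hk
  set D := √(fbmDet H s r) with hD
  have hD0 : 0 < D := Real.sqrt_pos.2 hΔ
  have hDD : fbmDet H s r = D ^ 2 := (Real.sq_sqrt hΔ.le).symm
  rw [hDD] at hk hge
  set m := min s r ^ H with hm
  set c := |r - s| ^ H with hc
  have hm0 : 0 < m := by positivity
  have hc0 : 0 < c := by positivity
  have hDge : κ * (m * c) ≤ D := by
    refine abs_le_of_sq_le_sq' ?_ hD0.le |>.2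
    rw [mul_pow, hκ, Real.sq_sqrt (by linarith)]
    exact hge
  have hmT : m ≤ T := Real.rpow_le_rpow hmin.le ((min_le_left _ _).trans hst) hH0.le
  have hab : s ^ H * r ^ H ≤ m * T := by
    rcases le_total s r with h | h
    · rw [hm, min_eq_left h]
      exact mul_le_mul_of_nonneg_left (Real.rpow_le_rpow hr.le hrt hH0.le) (by positivity)
    · rw [hm, min_eq_right h, mul_comm]
      exact mul_le_mul_of_nonneg_left (Real.rpow_le_rpow hs.le hst hH0.le) (by positivity)
  have hdet : D ^ 2 = (s ^ H * r ^ H) ^ 2 - fbmCov H s r ^ 2 := by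
    rw [← hDD, fbmDet, rpow_two_mul hs.le, rpow_two_mul hr.le]; ring
  have hab0 : 0 ≤ s ^ H * r ^ H := by positivity
  have hγ : |fbmCov H s r| ≤ m * T :=
    (abs_le_of_sq_le_sq (by nlinarith [sq_nonneg D]) hab0).trans hab
  have hDle : D ≤ m * T :=
    (abs_le_of_sq_le_sq' (by nlinarith [sq_nonneg (fbmCov H s r)]) hab0).2.trans hab
  have hmajor : (m ^ 2)⁻¹ * (c ^ 3)⁻¹ ≤ fbmMajorant H (s, r) := by
    unfold fbmMajorant
    have e1 : |r - s| ^ (-(3 * H)) = (c ^ 3)⁻¹ := by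
      rw [Real.rpow_neg hd.le, mul_comm, Real.rpow_mul hd.le, hc]; norm_cast
    have e2 : (m ^ 2)⁻¹ = min s r ^ (-(2 * H)) := by
      rw [Real.rpow_neg hmin.le, rpow_two_mul hmin.le]
    simp only [e1, e2]
    gcongr
    have h1 : 0 < s ^ (-(2 * H)) := by positivity
    have h2 : 0 < r ^ (-(2 * H)) := by positivity
    rcases min_choice s r with h | h <;> rw [h] <;> linarith
  have key : (D ^ 3)⁻¹ ≤ (κ ^ 3)⁻¹ * ((m ^ 3)⁻¹ * (c ^ 3)⁻¹) := by
    rw [← mul_inv, ← mul_inv, ← mul_pow, ← mul_pow]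
    gcongr
  have main : ∀ A : ℝ, 0 ≤ A → A ≤ 3 * T + T ^ 3 → m * A * (D ^ 3)⁻¹ ≤
      (3 * T + T ^ 3) / κ ^ 3 * fbmMajorant H (s, r) := by
    intro A hA0 hA
    calc m * A * (D ^ 3)⁻¹ ≤ m * (3 * T + T ^ 3) * ((κ ^ 3)⁻¹ * ((m ^ 3)⁻¹ * (c ^ 3)⁻¹)) := by
          gcongr
      _ = (3 * T + T ^ 3) / κ ^ 3 * ((m ^ 2)⁻¹ * (c ^ 3)⁻¹) := by field_simp
      _ ≤ _ := by gcongr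
  constructor
  · refine hq.trans (le_trans ?_ (main (T ^ 3) (by positivity) (by linarith)))
    calc D⁻¹ = D ^ 2 * (D ^ 3)⁻¹ := by field_simp
      _ ≤ (m * T) ^ 2 * (D ^ 3)⁻¹ := by gcongr
      _ = m * (m * T ^ 2) * (D ^ 3)⁻¹ := by ring
      _ ≤ m * (T * T ^ 2) * (D ^ 3)⁻¹ := by gcongr
      _ = _ := by ring
  · refine hk.trans (le_trans ?_ (main (3 * T) (by positivity) (by
      have : 0 < T ^ 3 := by positivity
      linarith)))
    calc _ = (D + 2 * |fbmCov H s r|) * (D ^ 3)⁻¹ := by field_simp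
      _ ≤ (m * T + 2 * (m * T)) * (D ^ 3)⁻¹ := by gcongr
      _ = _ := by ring

lemma integrableOn_rpow_neg {a t : ℝ} (ha : a < 1) (ht : 0 < t) :
    IntegrableOn (fun u : ℝ => u ^ (-a)) (Set.Ioc 0 t) := by
  rw [← intervalIntegrable_iff_integrableOn_Ioc_of_le ht.le]
  exact intervalIntegral.intervalIntegrable_rpow' (by linarith)

lemma integrableOn_abs_rpow_neg {a t : ℝ} (ha : a < 1) (ht : 0 < t) :
    IntegrableOn (fun u : ℝ => |u| ^ (-a)) (Set.Ioo (-t) t) := by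
  have h1 : IntegrableOn (fun u : ℝ => |u| ^ (-a)) (Set.Ioc 0 t) :=
    (integrableOn_rpow_neg ha ht).congr_fun (fun u hu => by simp only [abs_of_pos hu.1])
      measurableSet_Ioc
  have h2 : IntegrableOn (fun u : ℝ => |u| ^ (-a)) (Set.Ico (-t) 0) := by
    have := (((Measure.measurePreserving_neg (volume : Measure ℝ)).integrableOn_comp_preimage
      (Homeomorph.neg ℝ).measurableEmbedding).2 h1)
    simpa [Function.comp_def] using this
  have h3 : IntegrableOn (fun u : ℝ => |u| ^ (-a)) {0} := integrableOn_singleton (by simp) (by simp)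
  refine ((h2.union h3).union h1).mono_set fun u hu => ?_
  rcases lt_trichotomy u 0 with h | h | h
  · exact Or.inl (Or.inl ⟨hu.1.le, h⟩)
  · exact Or.inl (Or.inr h)
  · exact Or.inr ⟨h, hu.2.le⟩

/-- The time square `(0, t]²` with Lebesgue measure. -/
noncomputable def timeSquare (t : ℝ) : Measure (ℝ × ℝ) :=
  (volume.restrict (Set.Ioc 0 t)).prod (volume.restrict (Set.Ioc 0 t))

instance (t : ℝ) : IsFiniteMeasure (timeSquare t) := by unfold timeSquare; infer_instance

lemma ae_timeSquare (t : ℝ) : ∀ᵐ p ∂(timeSquare t),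
    p.1 ∈ Set.Ioc 0 t ∧ p.2 ∈ Set.Ioc 0 t ∧ p.1 ≠ p.2 := by
  have h1 : ∀ᵐ p ∂(timeSquare t), p.1 ≠ p.2 := by
    unfold timeSquare
    rw [Measure.ae_prod_iff_ae_ae (by measurability)]
    refine Eventually.of_forall fun x => ?_
    have : ∀ᵐ y ∂(volume.restrict (Set.Ioc 0 t)), y ≠ x :=
      ae_restrict_of_ae (by simp [ae_iff])
    filter_upwards [this] with y hy using hy.symm
  have h2 : ∀ᵐ p ∂(timeSquare t), p ∈ Set.Ioc 0 t ×ˢ Set.Ioc 0 t := by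
    unfold timeSquare
    rw [Measure.prod_restrict]
    exact ae_restrict_mem (measurableSet_Ioc.prod measurableSet_Ioc)
  filter_upwards [h1, h2] with p hp hp2 using ⟨hp2.1, hp2.2, hp⟩

lemma integrable_fbmMajorant {H t : ℝ} (hH0 : 0 < H) (hH : H < 1 / 3) (ht : 0 < t) :
    Integrable (fbmMajorant H) (timeSquare t) := by
  have hf : Integrable ((Set.Ioc 0 t).indicator fun u : ℝ => u ^ (-(2 * H))) :=
    (integrable_indicator_iff measurableSet_Ioc).2 (integrableOn_rpow_neg (by linarith) ht)
  have hg : Integrable ((Set.Ioo (-t) t).indicator fun u : ℝ => |u| ^ (-(3 * H))) :=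
    (integrable_indicator_iff measurableSet_Ioo).2 (integrableOn_abs_rpow_neg (by linarith) ht)
  have h := hf.convolution_integrand (ContinuousLinearMap.mul ℝ ℝ) hg
  have h2 := h.swap
  have hle : timeSquare t ≤ (volume : Measure ℝ).prod volume := by
    unfold timeSquare
    rw [Measure.prod_restrict]
    exact Measure.restrict_le_self
  refine ((h.mono_measure hle).add (h2.mono_measure hle)).congr ?_
  filter_upwards [ae_timeSquare t] with p ⟨h1, h2, h3⟩
  have m1 : p.1 - p.2 ∈ Set.Ioo (-t) t := by
    constructor <;> linarith [h1.1, h1.2, h2.1, h2.2]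
  have m2 : p.2 - p.1 ∈ Set.Ioo (-t) t := by
    constructor <;> linarith [h1.1, h1.2, h2.1, h2.2]
  simp only [Pi.add_apply, ContinuousLinearMap.mul_apply', Function.comp, Prod.fst_swap,
    Prod.snd_swap, Set.indicator_of_mem h1, Set.indicator_of_mem h2, Set.indicator_of_mem m1,
    Set.indicator_of_mem m2, fbmMajorant]
  rw [abs_sub_comm p.1 p.2]
  ring

lemma measurable_fbmCov (H : ℝ) : Measurable (fun p : ℝ × ℝ => fbmCov H p.1 p.2) := by
  unfold fbmCov; fun_prop

lemma measurable_fbmDensity_uncurry (H : ℝ) :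
    Measurable (fun z : (ℝ × ℝ) × (ℝ × ℝ) => fbmDensity H z.1 z.2.1 z.2.2) := by
  have h : Measurable (fun z : (ℝ × ℝ) × (ℝ × ℝ) => fbmCov H z.1.1 z.1.2) :=
    (measurable_fbmCov H).comp measurable_fst
  unfold fbmDensity pairDensity
  exact (measurable_heatKernel_uncurry.comp (f := fun z : (ℝ × ℝ) × (ℝ × ℝ) =>
    (z.1.1 ^ (2 * H), z.2.1)) (by fun_prop)).mul
    (measurable_heatKernel_uncurry.comp (f := fun z : (ℝ × ℝ) × (ℝ × ℝ) =>
    (z.1.2 ^ (2 * H) - fbmCov H z.1.1 z.1.2 ^ 2 / z.1.1 ^ (2 * H),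
      z.2.2 - fbmCov H z.1.1 z.1.2 / z.1.1 ^ (2 * H) * z.2.1)) (by fun_prop))

lemma measurable_fbmDensityMixed_uncurry (H : ℝ) :
    Measurable (fun z : (ℝ × ℝ) × (ℝ × ℝ) => fbmDensityMixed H z.1 z.2.1 z.2.2) := by
  have h : Measurable (fun z : (ℝ × ℝ) × (ℝ × ℝ) => fbmCov H z.1.1 z.1.2) :=
    (measurable_fbmCov H).comp measurable_fst
  unfold fbmDensityMixed pairDensityMixed
  have hx : Measurable (fun z : (ℝ × ℝ) × (ℝ × ℝ) => (z.1.1 ^ (2 * H), z.2.1)) := by fun_prop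
  have hy : Measurable (fun z : (ℝ × ℝ) × (ℝ × ℝ) =>
    (z.1.2 ^ (2 * H) - fbmCov H z.1.1 z.1.2 ^ 2 / z.1.1 ^ (2 * H),
      z.2.2 - fbmCov H z.1.1 z.1.2 / z.1.1 ^ (2 * H) * z.2.1)) := by fun_prop
  exact ((measurable_heatKernelDeriv_uncurry.comp hx).mul
    (measurable_heatKernelDeriv_uncurry.comp hy)).sub
    (Measurable.mul (by fun_prop) ((measurable_heatKernel_uncurry.comp hx).mul
    (measurable_heatKernelDeriv₂_uncurry.comp hy)))

/-! ### Kernels depending on a parameter -/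

/-- A measurable family of kernels `k p` on `ℝ × ℝ`, continuous for almost every `p` and bounded
by a `μ`-integrable function of `p`. -/
structure IsDominatedKernel {α : Type*} [MeasurableSpace α] (μ : Measure α)
    (k : α → ℝ → ℝ → ℝ) : Prop where
  measurable : Measurable (fun z : α × (ℝ × ℝ) => k z.1 z.2.1 z.2.2)
  continuous : ∀ᵐ p ∂μ, Continuous (fun z : ℝ × ℝ => k p z.1 z.2)
  bound : ∃ M : α → ℝ, Integrable M μ ∧ ∀ᵐ p ∂μ, ∀ x y, |k p x y| ≤ M p

/-- The kernel averaged over its parameter. -/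
noncomputable def averagedKernel {α : Type*} [MeasurableSpace α] (μ : Measure α)
    (k : α → ℝ → ℝ → ℝ) (x y : ℝ) : ℝ := ∫ p, k p x y ∂μ

section Kernel

variable {α : Type*} [MeasurableSpace α] {μ : Measure α} {k : α → ℝ → ℝ → ℝ}

lemma IsDominatedKernel.continuous_averagedKernel (hk : IsDominatedKernel μ k) :
    Continuous (fun z : ℝ × ℝ => averagedKernel μ k z.1 z.2) := by
  obtain ⟨M, hM, hb⟩ := hk.bound
  refine continuous_of_dominated (bound := M) (fun z => ?_) (fun z => ?_) hM hk.continuous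
  · exact (hk.measurable.comp (measurable_id.prodMk measurable_const)).aestronglyMeasurable
  · filter_upwards [hb] with p hp using hp _ _

lemma IsDominatedKernel.exists_bound_averagedKernel (hk : IsDominatedKernel μ k) :
    ∃ C, ∀ x y, |averagedKernel μ k x y| ≤ C := by
  obtain ⟨M, hM, hb⟩ := hk.bound
  refine ⟨∫ p, M p ∂μ, fun x y => norm_integral_le_of_norm_le (f := fun p => k p x y) hM ?_⟩
  filter_upwards [hb] with p hp using hp _ _

lemma IsDominatedKernel.integrable_mul [SFinite μ] (hk : IsDominatedKernel μ k) {G₁ G₂ : ℝ → ℝ}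
    (h₁ : Integrable G₁) (h₂ : Integrable G₂) :
    Integrable (fun w : α × (ℝ × ℝ) => G₁ w.2.1 * G₂ w.2.2 * k w.1 w.2.1 w.2.2)
      (μ.prod volume) := by
  obtain ⟨M, hM, hb⟩ := hk.bound
  have hG : Integrable (fun z : ℝ × ℝ => G₁ z.1 * G₂ z.2) := h₁.mul_prod h₂
  have hi : Integrable (fun w : α × (ℝ × ℝ) => M w.1 * (G₁ w.2.1 * G₂ w.2.2)) (μ.prod volume) :=
    hM.mul_prod hG
  refine hi.mono ?_ ?_
  · exact (hG.aestronglyMeasurable.comp_snd).mul hk.measurable.aestronglyMeasurable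
  · have hb' : ∀ᵐ w ∂(μ.prod (volume : Measure (ℝ × ℝ))), ∀ x y, |k w.1 x y| ≤ M w.1 :=
      Measure.quasiMeasurePreserving_fst.ae hb
    filter_upwards [hb'] with w hw
    rw [norm_mul, norm_mul (M w.1), mul_comm]
    exact mul_le_mul_of_nonneg_right ((hw _ _).trans (le_abs_self _)) (norm_nonneg _)

lemma IsDominatedKernel.integral_swap [SFinite μ] (hk : IsDominatedKernel μ k) {G₁ G₂ : ℝ → ℝ}
    (h₁ : Integrable G₁) (h₂ : Integrable G₂) :
    ∫ p, (∫ z : ℝ × ℝ, G₁ z.1 * G₂ z.2 * k p z.1 z.2) ∂μ =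
      ∫ z : ℝ × ℝ, G₁ z.1 * G₂ z.2 * averagedKernel μ k z.1 z.2 := by
  rw [integral_integral_swap (hk.integrable_mul h₁ h₂)]
  simp only [averagedKernel, integral_const_mul]

end Kernel

lemma isDominatedKernel_fbmDensity {H t : ℝ} (hH0 : 0 < H) (hH : H < 1 / 3) (ht : 0 < t) :
    IsDominatedKernel (timeSquare t) (fbmDensity H) where
  measurable := measurable_fbmDensity_uncurry H
  continuous := Eventually.of_forall fun _ => continuous_pairDensity _ _ _
  bound := by
    obtain ⟨C, hC⟩ := fbmDensity_bounds hH0 (by linarith) ht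
    refine ⟨_, (integrable_fbmMajorant hH0 hH ht).const_mul C, ?_⟩
    filter_upwards [ae_timeSquare t] with p hp x y using (hC p hp.1 hp.2.1 hp.2.2 x y).1

lemma isDominatedKernel_fbmDensityMixed {H t : ℝ} (hH0 : 0 < H) (hH : H < 1 / 3) (ht : 0 < t) :
    IsDominatedKernel (timeSquare t) (fbmDensityMixed H) where
  measurable := measurable_fbmDensityMixed_uncurry H
  continuous := Eventually.of_forall fun _ => continuous_pairDensityMixed _ _ _
  bound := by
    obtain ⟨C, hC⟩ := fbmDensity_bounds hH0 (by linarith) ht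
    refine ⟨_, (integrable_fbmMajorant hH0 hH ht).const_mul C, ?_⟩
    filter_upwards [ae_timeSquare t] with p hp x y using (hC p hp.1 hp.2.1 hp.2.2 x y).2

lemma measurable_fbmDensity (H : ℝ) (p : ℝ × ℝ) :
    Measurable (fun z : ℝ × ℝ => fbmDensity H p z.1 z.2) :=
  (continuous_pairDensity _ _ _).measurable

lemma fbmDensity_nonneg {H : ℝ} (hH0 : 0 < H) (hH1 : H < 1) {p : ℝ × ℝ} (h1 : 0 < p.1)
    (h2 : 0 < p.2) (h12 : p.1 ≠ p.2) (x y : ℝ) : 0 ≤ fbmDensity H p x y :=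
  pairDensity_nonneg (by positivity) (fbmDet_pos hH0 hH1 h1 h2 h12) x y

/-! ### Second moments of additive functionals -/

/-- A jointly measurable process on `ℝ` whose law at two distinct positive times is that of
fractional Brownian motion with Hurst parameter `H`. -/
structure HasFBMPairLaw {Ω : Type*} [MeasurableSpace Ω] (H : ℝ) (X : ℝ → Ω → ℝ)
    (P : Measure Ω) : Prop where
  measurable : Measurable (fun z : ℝ × Ω => X z.1 z.2)
  map_eq : ∀ p : ℝ × ℝ, 0 < p.1 → 0 < p.2 → p.1 ≠ p.2 →
    P.map (fun ω => (X p.1 ω, X p.2 ω)) = (volume : Measure (ℝ × ℝ)).withDensity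
      (fun z => ENNReal.ofReal (fbmDensity H p z.1 z.2))

/-- The additive functional `∫_0^t g(X_s) ds`. -/
noncomputable def additiveFunctional {Ω : Type*} (X : ℝ → Ω → ℝ) (t : ℝ) (g : ℝ → ℝ) (ω : Ω) : ℝ :=
  ∫ s in Set.Ioc 0 t, g (X s ω)

lemma additiveFunctional_mul {Ω : Type*} (X : ℝ → Ω → ℝ) (t : ℝ) (g h : ℝ → ℝ) (ω : Ω) :
    additiveFunctional X t g ω * additiveFunctional X t h ω =
      ∫ p, g (X p.1 ω) * h (X p.2 ω) ∂(timeSquare t) := by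
  unfold additiveFunctional timeSquare
  rw [← integral_prod_mul]

section Moments

variable {Ω : Type*} [MeasurableSpace Ω] {H t : ℝ} {X : ℝ → Ω → ℝ} {P : Measure Ω}
  {g h : ℝ → ℝ}

lemma HasFBMPairLaw.measurable_apply (hX : HasFBMPairLaw H X P) (s : ℝ) : Measurable (X s) :=
  hX.measurable.comp measurable_prodMk_left

lemma HasFBMPairLaw.integral_eq (hX : HasFBMPairLaw H X P) (hH0 : 0 < H) (hH1 : H < 1)
    {p : ℝ × ℝ} (h1 : 0 < p.1) (h2 : 0 < p.2) (h12 : p.1 ≠ p.2)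
    {F : ℝ × ℝ → ℝ} (hF : Measurable F) :
    ∫ ω, F (X p.1 ω, X p.2 ω) ∂P = ∫ z : ℝ × ℝ, F z * fbmDensity H p z.1 z.2 := by
  have hm : Measurable (fun ω => (X p.1 ω, X p.2 ω)) :=
    (hX.measurable_apply _).prodMk (hX.measurable_apply _)
  rw [← integral_map (f := F) hm.aemeasurable hF.aestronglyMeasurable, hX.map_eq p h1 h2 h12,
    integral_withDensity_eq_integral_toReal_smul
      (measurable_fbmDensity H p).ennreal_ofReal
      (Eventually.of_forall fun _ => ENNReal.ofReal_lt_top)]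
  refine integral_congr_ae (Eventually.of_forall fun z => ?_)
  simp only [smul_eq_mul]
  rw [ENNReal.toReal_ofReal (fbmDensity_nonneg hH0 hH1 h1 h2 h12 _ _), mul_comm]

lemma HasFBMPairLaw.integrable_iff (hX : HasFBMPairLaw H X P) (hH0 : 0 < H) (hH1 : H < 1)
    {p : ℝ × ℝ} (h1 : 0 < p.1) (h2 : 0 < p.2) (h12 : p.1 ≠ p.2)
    {F : ℝ × ℝ → ℝ} (hF : Measurable F) :
    Integrable (fun ω => F (X p.1 ω, X p.2 ω)) P ↔
      Integrable (fun z : ℝ × ℝ => F z * fbmDensity H p z.1 z.2) := by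
  have hm : Measurable (fun ω => (X p.1 ω, X p.2 ω)) :=
    (hX.measurable_apply _).prodMk (hX.measurable_apply _)
  have := integrable_map_measure (μ := P) (g := F) hF.aestronglyMeasurable hm.aemeasurable
  rw [Function.comp_def] at this
  rw [← this, hX.map_eq p h1 h2 h12, integrable_withDensity_iff
      (measurable_fbmDensity H p).ennreal_ofReal
      (Eventually.of_forall fun _ => ENNReal.ofReal_lt_top)]
  refine integrable_congr (Eventually.of_forall fun z => ?_)
  simp only
  rw [ENNReal.toReal_ofReal (fbmDensity_nonneg hH0 hH1 h1 h2 h12 _ _)]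

variable [IsProbabilityMeasure P]

lemma HasFBMPairLaw.integrable_prod (hX : HasFBMPairLaw H X P) (hH0 : 0 < H) (hH : H < 1 / 3)
    (ht : 0 < t) (hg : Measurable g) (hgi : Integrable g) (hh : Measurable h)
    (hhi : Integrable h) :
    Integrable (fun w : (ℝ × ℝ) × Ω => g (X w.1.1 w.2) * h (X w.1.2 w.2))
      ((timeSquare t).prod P) := by
  have hm : Measurable (fun w : (ℝ × ℝ) × Ω => g (X w.1.1 w.2) * h (X w.1.2 w.2)) :=
    (hg.comp (hX.measurable.comp (by fun_prop : Measurable fun w : (ℝ × ℝ) × Ω =>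
      (w.1.1, w.2)))).mul
    (hh.comp (hX.measurable.comp (by fun_prop : Measurable fun w : (ℝ × ℝ) × Ω =>
      (w.1.2, w.2))))
  have hker := (isDominatedKernel_fbmDensity hH0 hH ht).integrable_mul hgi hhi
  have hF : Measurable (fun z : ℝ × ℝ => g z.1 * h z.2) := by fun_prop
  rw [integrable_prod_iff hm.aestronglyMeasurable]
  constructor
  · filter_upwards [ae_timeSquare t, hker.prod_right_ae] with p ⟨h1, h2, h12⟩ hp
    exact (hX.integrable_iff hH0 (by linarith) h1.1 h2.1 h12 hF).2 hp
  · refine hker.norm.integral_prod_left.congr ?_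
    filter_upwards [ae_timeSquare t] with p ⟨h1, h2, h12⟩
    have := hX.integral_eq hH0 (by linarith) h1.1 h2.1 h12 hF.norm
    simp only at this ⊢
    rw [this]
    refine integral_congr_ae (Eventually.of_forall fun z => ?_)
    simp only
    rw [norm_mul, Real.norm_of_nonneg (fbmDensity_nonneg hH0 (by linarith) h1.1 h2.1 h12 _ _)]

lemma HasFBMPairLaw.ae_integrableOn (hX : HasFBMPairLaw H X P) (hH0 : 0 < H) (hH : H < 1 / 3)
    (ht : 0 < t) (hg : Measurable g) (hgi : Integrable g) :
    ∀ᵐ ω ∂P, IntegrableOn (fun s => g (X s ω)) (Set.Ioc 0 t) := by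
  -- Pairing `g` with a positive function in the other time variable gives the first moment.
  have hi := hX.integrable_prod hH0 hH ht hg hgi (continuous_heatKernel 1).measurable
    (integrable_heatKernel one_pos)
  filter_upwards [hi.prod_left_ae] with ω hω
  have h2 : ∀ᵐ r ∂(volume.restrict (Set.Ioc 0 t)), IntegrableOn
      (fun s => g (X s ω) * heatKernel 1 (X r ω)) (Set.Ioc 0 t) := Integrable.prod_left_ae
    (f := fun p : ℝ × ℝ => g (X p.1 ω) * heatKernel 1 (X p.2 ω)) hω
  have : NeZero (volume.restrict (Set.Ioc 0 t)) :=
    ⟨by simpa [Measure.restrict_eq_zero] using ht⟩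
  obtain ⟨r, hr⟩ := h2.exists
  have hu : IsUnit (heatKernel 1 (X r ω)) := (heatKernel_pos one_pos _).ne'.isUnit
  exact (integrable_mul_const_iff hu _).1 hr

lemma HasFBMPairLaw.memLp_additiveFunctional (hX : HasFBMPairLaw H X P) (hH0 : 0 < H)
    (hH : H < 1 / 3) (ht : 0 < t) (hg : Measurable g) (hgi : Integrable g) :
    MemLp (additiveFunctional X t g) 2 P := by
  have hm : Measurable (fun w : Ω × ℝ => g (X w.2 w.1)) :=
    hg.comp (hX.measurable.comp measurable_swap)
  have hI : StronglyMeasurable (additiveFunctional X t g) :=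
    hm.stronglyMeasurable.integral_prod_right
  rw [memLp_two_iff_integrable_sq hI.aestronglyMeasurable]
  have hi := (hX.integrable_prod hH0 hH ht hg hgi hg hgi).integral_prod_right
  refine hi.congr (Eventually.of_forall fun ω => ?_)
  simp only [pow_two]
  rw [additiveFunctional_mul]

lemma HasFBMPairLaw.integral_additiveFunctional_mul (hX : HasFBMPairLaw H X P) (hH0 : 0 < H)
    (hH : H < 1 / 3) (ht : 0 < t) (hg : Measurable g) (hgi : Integrable g) (hh : Measurable h)
    (hhi : Integrable h) :
    ∫ ω, additiveFunctional X t g ω * additiveFunctional X t h ω ∂P =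
      ∫ p, (∫ z : ℝ × ℝ, g z.1 * h z.2 * fbmDensity H p z.1 z.2) ∂(timeSquare t) := by
  simp only [additiveFunctional_mul]
  rw [← integral_integral_swap (f := fun (p : ℝ × ℝ) ω => g (X p.1 ω) * h (X p.2 ω))
     (hX.integrable_prod hH0 hH ht hg hgi hh hhi)]
  refine integral_congr_ae ?_
  filter_upwards [ae_timeSquare t] with p ⟨h1, h2, h12⟩
  exact hX.integral_eq hH0 (by linarith) h1.1 h2.1 h12
    (F := fun z : ℝ × ℝ => g z.1 * h z.2) (by fun_prop)

end Moments

/-! ### Integration by parts -/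

/-- The primitive of `g` vanishing at `-∞`. -/
noncomputable def primitive (g : ℝ → ℝ) (x : ℝ) : ℝ := ∫ y in Set.Iic x, g y

/-- The mass of `|g|` outside the interval `(-|x|, |x|)`. -/
noncomputable def tailMass (g : ℝ → ℝ) (x : ℝ) : ℝ := ∫ y in {y : ℝ | |x| ≤ |y|}, |g y|

lemma measurableSet_abs_ge (x : ℝ) : MeasurableSet {y : ℝ | |x| ≤ |y|} :=
  measurableSet_le measurable_const (by fun_prop)

/-- Integration by parts with the primitive of an integrable function. -/
lemma integral_mul_eq_neg_integral_primitive_mul {h φ φ' : ℝ → ℝ} (hh : Integrable h)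
    (hφ : ∀ x, HasDerivAt φ (φ' x) x) (hφ' : Integrable φ') (h0 : Tendsto φ atTop (𝓝 0)) :
    ∫ y, h y * φ y = -∫ x, primitive h x * φ' x := by
  have e1 : ∀ y, φ y = -∫ x in Set.Ici y, φ' x := fun y => by
    rw [integral_Ici_eq_integral_Ioi, integral_Ioi_of_hasDerivAt_of_tendsto' (fun x _ => hφ x)
      hφ'.integrableOn h0]
    ring
  have hint : Integrable (fun z : ℝ × ℝ => h z.1 * φ' z.2) := hh.mul_prod hφ'
  have hms : MeasurableSet {z : ℝ × ℝ | z.1 ≤ z.2} :=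
    measurableSet_le measurable_fst measurable_snd
  have hi2 := hint.indicator hms
  calc ∫ y, h y * φ y
      = -∫ y, ∫ x, {z : ℝ × ℝ | z.1 ≤ z.2}.indicator (fun z => h z.1 * φ' z.2) (y, x) := by
        rw [← integral_neg]
        refine integral_congr_ae (Eventually.of_forall fun y => ?_)
        simp only
        rw [e1, mul_neg, ← integral_indicator measurableSet_Ici, ← integral_const_mul]
        congr 2
        ext x
        by_cases hx : y ≤ x <;> simp [Set.indicator, hx]
    _ = -∫ x, ∫ y, {z : ℝ × ℝ | z.1 ≤ z.2}.indicator (fun z => h z.1 * φ' z.2) (y, x) := by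
        rw [integral_integral_swap (f := fun y x =>
          {z : ℝ × ℝ | z.1 ≤ z.2}.indicator (fun z => h z.1 * φ' z.2) (y, x)) hi2]
    _ = -∫ x, primitive h x * φ' x := by
        congr 1
        refine integral_congr_ae (Eventually.of_forall fun x => ?_)
        simp only [primitive]
        rw [← integral_indicator measurableSet_Iic, ← integral_mul_const]
        congr 1
        ext y
        by_cases hx : y ≤ x <;> simp [Set.indicator, hx]

section PairDensityParts

variable {v γ u : ℝ}

lemma hasDerivAt_pairDensity (hv : 0 < v) (hΔ : 0 < v * u - γ ^ 2) (x y : ℝ) :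
    HasDerivAt (fun y => pairDensity v γ u x y) (pairDensityDeriv v γ u x y) y := by
  have := (hasDerivAt_heatKernel (condVar_pos hv hΔ) (y - γ / v * x)).comp_sub_const y (γ / v * x)
  exact this.const_mul _

lemma hasDerivAt_pairDensityDeriv (hv : 0 < v) (hΔ : 0 < v * u - γ ^ 2) (x y : ℝ) :
    HasDerivAt (fun x => pairDensityDeriv v γ u x y) (pairDensityMixed v γ u x y) x := by
  have h1 : HasDerivAt (fun x => y - γ / v * x) (-(γ / v)) x := by
    simpa using ((hasDerivAt_id x).const_mul (γ / v)).const_sub y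
  have := (hasDerivAt_heatKernelDeriv (condVar_pos hv hΔ) (y - γ / v * x)).comp x h1
  refine ((hasDerivAt_heatKernel hv x).mul this).congr_deriv ?_
  simp only [pairDensityMixed, Function.comp]
  ring

lemma abs_pairDensityDeriv_le (hv : 0 < v) (hΔ : 0 < v * u - γ ^ 2) (x y : ℝ) :
    |pairDensityDeriv v γ u x y| ≤ (√v)⁻¹ * (u - γ ^ 2 / v)⁻¹ := by
  rw [pairDensityDeriv, abs_mul]
  exact mul_le_mul (abs_heatKernel_le hv _) (abs_heatKernelDeriv_le (condVar_pos hv hΔ) _)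
    (abs_nonneg _) (by positivity)

/-- The joint density of a Gaussian pair tested against `g ⊗ h`: both derivatives hidden in
`g = (primitive g)'` and `h = (primitive h)'` are moved onto the density. -/
lemma integral_mul_pairDensity (hv : 0 < v) (hΔ : 0 < v * u - γ ^ 2) {g h : ℝ → ℝ}
    (hg : Integrable g) (hh : Integrable h) (hGi : Integrable (primitive g))
    (hHi : Integrable (primitive h)) :
    ∫ z : ℝ × ℝ, g z.1 * h z.2 * pairDensity v γ u z.1 z.2 =
      ∫ z : ℝ × ℝ, primitive g z.1 * primitive h z.2 * pairDensityMixed v γ u z.1 z.2 := by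
  have hw := condVar_pos hv hΔ
  have bdd : ∀ {f₁ f₂ : ℝ → ℝ} {k : ℝ → ℝ → ℝ} {C : ℝ}, Integrable f₁ → Integrable f₂ →
      Continuous (fun z : ℝ × ℝ => k z.1 z.2) → (∀ x y, |k x y| ≤ C) →
      Integrable (fun z : ℝ × ℝ => f₁ z.1 * f₂ z.2 * k z.1 z.2) := by
    intro f₁ f₂ k C h₁ h₂ hk hb
    exact (h₁.mul_prod h₂).mul_bdd hk.aestronglyMeasurable
      (Eventually.of_forall fun z => hb _ _)
  have i0 := bdd hg hh (continuous_pairDensity v γ u) (abs_pairDensity_le hv hΔ)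
  have i1 := bdd hg hHi (continuous_pairDensityDeriv v γ u) (abs_pairDensityDeriv_le hv hΔ)
  have i2 := bdd hGi hHi (continuous_pairDensityMixed v γ u) (abs_pairDensityMixed_le hv hΔ)
  have s1 : ∀ x, ∫ y, h y * pairDensity v γ u x y
      = -∫ y, primitive h y * pairDensityDeriv v γ u x y := fun x => by
    refine integral_mul_eq_neg_integral_primitive_mul hh (hasDerivAt_pairDensity hv hΔ x) ?_ ?_
    · exact ((integrable_heatKernelDeriv hw).comp_sub_right _).const_mul _
    · have h1 : Tendsto (fun y => y - γ / v * x) atTop atTop :=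
        tendsto_atTop_add_const_right _ _ tendsto_id
      have := ((tendsto_heatKernel_cocompact hw).comp
        (h1.mono_right atTop_le_cocompact)).const_mul (heatKernel v x)
      rw [mul_zero] at this
      exact this
  have s2 : ∀ y, ∫ x, g x * pairDensityDeriv v γ u x y
      = -∫ x, primitive g x * pairDensityMixed v γ u x y := fun y => by
    refine integral_mul_eq_neg_integral_primitive_mul hg
      (fun x => hasDerivAt_pairDensityDeriv hv hΔ x y) ?_ ?_
    · have c : Continuous (fun x => y - γ / v * x) := by fun_prop
      have j1 : Integrable (fun x => heatKernelDeriv v x *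
          heatKernelDeriv (u - γ ^ 2 / v) (y - γ / v * x)) :=
        (integrable_heatKernelDeriv hv).mul_bdd
          ((continuous_heatKernelDeriv _).comp c).aestronglyMeasurable
          (Eventually.of_forall fun x => abs_heatKernelDeriv_le hw _)
      have j2 : Integrable (fun x => heatKernel v x *
          heatKernelDeriv₂ (u - γ ^ 2 / v) (y - γ / v * x)) :=
        (integrable_heatKernel hv).mul_bdd
          ((continuous_heatKernelDeriv₂ _).comp c).aestronglyMeasurable
          (Eventually.of_forall fun x => abs_heatKernelDeriv₂_le hw _)
      exact j1.sub (j2.const_mul _)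
    · have h0 := (tendsto_heatKernel_cocompact hv).mono_left atTop_le_cocompact
      have := h0.zero_mul_isBoundedUnder_le
        (g := fun x => heatKernelDeriv (u - γ ^ 2 / v) (y - γ / v * x))
        (isBoundedUnder_of ⟨_, fun x => abs_heatKernelDeriv_le hw _⟩)
      exact this
  calc ∫ z : ℝ × ℝ, g z.1 * h z.2 * pairDensity v γ u z.1 z.2
      = ∫ x, ∫ y, g x * h y * pairDensity v γ u x y := integral_prod _ i0
    _ = -∫ x, ∫ y, g x * primitive h y * pairDensityDeriv v γ u x y := by
        rw [← integral_neg]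
        congr 1; ext x
        simp only [mul_assoc, integral_const_mul, s1, mul_neg]
    _ = -∫ y, ∫ x, g x * primitive h y * pairDensityDeriv v γ u x y := by
        rw [integral_integral_swap i1]
    _ = ∫ y, ∫ x, primitive g x * primitive h y * pairDensityMixed v γ u x y := by
        rw [← integral_neg]
        congr 1; ext y
        simp only [mul_comm _ (primitive h y), mul_assoc, integral_const_mul, s2, mul_neg, neg_neg]
    _ = _ := (integral_prod_symm _ i2).symm

end PairDensityParts

/-! ### Primitives and tails -/

section Primitive

variable {g : ℝ → ℝ}

lemma integrable_prod_tail (hg : Integrable g) (hg1 : Integrable (fun y => y * g y)) :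
    Integrable (fun z : ℝ × ℝ => {z : ℝ × ℝ | |z.1| ≤ |z.2|}.indicator (fun z => |g z.2|) z) := by
  have hms : MeasurableSet {z : ℝ × ℝ | |z.1| ≤ |z.2|} :=
    measurableSet_le (by fun_prop) (by fun_prop)
  have hm : AEStronglyMeasurable
      (fun z : ℝ × ℝ => {z : ℝ × ℝ | |z.1| ≤ |z.2|}.indicator (fun z => |g z.2|) z)
      (volume.prod volume) :=
    (hg.abs.aestronglyMeasurable.comp_snd).indicator hms
  have e : ∀ y, (fun x => {z : ℝ × ℝ | |z.1| ≤ |z.2|}.indicator (fun z => |g z.2|) (x, y)) =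
      (Set.Icc (-|y|) |y|).indicator (fun _ => |g y|) := by
    intro y; ext x
    by_cases hx : |x| ≤ |y|
    · rw [Set.indicator_of_mem (by simpa using hx),
        Set.indicator_of_mem (Set.mem_Icc.2 (abs_le.1 hx))]
    · rw [Set.indicator_of_notMem (by simpa using hx),
        Set.indicator_of_notMem (fun h => hx (abs_le.2 (Set.mem_Icc.1 h)))]
  rw [Measure.volume_eq_prod, integrable_prod_iff' hm]
  constructor
  · refine Eventually.of_forall fun y => ?_
    rw [e, integrable_indicator_iff measurableSet_Icc]
    exact integrableOn_const (by simp)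
  · refine (hg1.norm.const_mul 2).congr (Eventually.of_forall fun y => ?_)
    have : ∀ x, ‖{z : ℝ × ℝ | |z.1| ≤ |z.2|}.indicator (fun z => |g z.2|) (x, y)‖ =
        (Set.Icc (-|y|) |y|).indicator (fun _ => |g y|) x := fun x => by
      rw [← congrFun (e y) x, Real.norm_of_nonneg]
      exact Set.indicator_nonneg (fun _ _ => abs_nonneg _) _
    simp only [this]
    rw [integral_indicator measurableSet_Icc, setIntegral_const]
    simp [Measure.real, norm_mul]
    ring

lemma tailMass_eq (x : ℝ) : tailMass g x =
    ∫ y, {z : ℝ × ℝ | |z.1| ≤ |z.2|}.indicator (fun z => |g z.2|) (x, y) := by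
  unfold tailMass
  rw [← integral_indicator (measurableSet_abs_ge x)]
  rfl

lemma integrable_tailMass (hg : Integrable g) (hg1 : Integrable (fun y => y * g y)) :
    Integrable (tailMass g) := by
  refine (integrable_prod_tail hg hg1).integral_prod_left.congr (Eventually.of_forall fun x => ?_)
  rw [tailMass_eq]

/-- The function `1_{y ≤ x} - 1_{0 ≤ x}`. -/
noncomputable def stepDiff (x y : ℝ) : ℝ := (if y ≤ x then 1 else 0) - (if 0 ≤ x then 1 else 0)

/-- For `g` of mean zero, `primitive g x` is the integral of `g` against `stepDiff x`, which is
supported in `{|x| ≤ |y|}`. -/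
lemma primitive_eq_of_integral_eq_zero (hg : Integrable g) (h0 : ∫ y, g y = 0) (x : ℝ) :
    primitive g x = ∫ y, g y * stepDiff x y := by
  have e : ∀ y, g y * stepDiff x y =
      (Set.Iic x).indicator g y - g y * (if 0 ≤ x then 1 else 0) := fun y => by
    by_cases hx : y ≤ x <;> simp [Set.indicator, stepDiff, hx, mul_sub]
  simp only [e]
  rw [integral_sub (hg.indicator measurableSet_Iic) (hg.mul_const _), integral_mul_const, h0,
    integral_indicator measurableSet_Iic]
  simp [primitive]

lemma abs_mul_stepDiff_le (x y : ℝ) (a : ℝ) :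
    |a * stepDiff x y| ≤
      {z : ℝ × ℝ | |z.1| ≤ |z.2|}.indicator (fun _ => |a|) (x, y) := by
  unfold stepDiff
  by_cases h : |x| ≤ |y|
  · rw [Set.indicator_of_mem (by exact h), abs_mul]
    refine mul_le_of_le_one_right (abs_nonneg _) ?_
    by_cases h1 : y ≤ x <;> by_cases h2 : 0 ≤ x <;> simp [h1, h2]
  · rw [Set.indicator_of_notMem (by exact h)]
    have : (y ≤ x ↔ 0 ≤ x) := by
      constructor
      · intro h1
        by_contra h2
        rw [abs_of_neg (not_le.1 h2), abs_of_nonpos (h1.trans (not_le.1 h2).le)] at h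
        exact h (by linarith)
      · intro h2
        rw [abs_of_nonneg h2] at h
        exact (le_abs_self y).trans (not_le.1 h).le
    simp [this]

lemma abs_primitive_le_tailMass (hg : Integrable g) (h0 : ∫ y, g y = 0) (x : ℝ) :
    |primitive g x| ≤ tailMass g x := by
  rw [primitive_eq_of_integral_eq_zero hg h0, tailMass_eq]
  refine norm_integral_le_of_norm_le (f := fun y => g y * stepDiff x y)
    (g := fun y => {z : ℝ × ℝ | |z.1| ≤ |z.2|}.indicator (fun z => |g z.2|) (x, y)) ?_
    (Eventually.of_forall fun y => ?_)
  · exact hg.abs.indicator (measurableSet_abs_ge x)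
  · exact abs_mul_stepDiff_le x y (g y)

lemma integrable_prod_primitive (hg : Integrable g) (hg1 : Integrable (fun y => y * g y)) :
    Integrable (fun z : ℝ × ℝ => g z.2 * stepDiff z.1 z.2) := by
  refine (integrable_prod_tail hg hg1).mono' ?_ (Eventually.of_forall fun z => ?_)
  · have m : Measurable (fun z : ℝ × ℝ => stepDiff z.1 z.2) :=
      (Measurable.ite (measurableSet_le measurable_snd measurable_fst)
        measurable_const measurable_const).sub (Measurable.ite
        (measurableSet_le measurable_const measurable_fst) measurable_const measurable_const)
    exact hg.aestronglyMeasurable.comp_snd.mul m.aestronglyMeasurable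
  · exact abs_mul_stepDiff_le z.1 z.2 (g z.2)

lemma integrable_primitive (hg : Integrable g) (hg1 : Integrable (fun y => y * g y))
    (h0 : ∫ y, g y = 0) : Integrable (primitive g) := by
  refine (integrable_prod_primitive hg hg1).integral_prod_left.congr
    (Eventually.of_forall fun x => ?_)
  simp only [primitive_eq_of_integral_eq_zero hg h0]

lemma integral_primitive (hg : Integrable g) (hg1 : Integrable (fun y => y * g y))
    (h0 : ∫ y, g y = 0) : ∫ x, primitive g x = -∫ y, y * g y := by
  simp only [primitive_eq_of_integral_eq_zero hg h0]
  rw [integral_integral_swap (f := fun x y => g y * stepDiff x y)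
    (integrable_prod_primitive hg hg1), ← integral_neg]
  refine integral_congr_ae (Eventually.of_forall fun y => ?_)
  simp only [integral_const_mul]
  have : ∫ x, stepDiff x y = -y := by
    rcases le_total 0 y with h | h
    · have e : ∀ x, stepDiff x y =
          -(Set.Ico 0 y).indicator (1 : ℝ → ℝ) x := fun x => by
        by_cases h1 : y ≤ x
        · simp [stepDiff, Set.indicator, h1, h.trans h1]
        · by_cases h2 : 0 ≤ x <;> simp [stepDiff, Set.indicator, h1, h2, not_le.1 h1]
      simp only [e, integral_neg]
      rw [integral_indicator_one measurableSet_Ico]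
      simp [Measure.real, h]
    · have e : ∀ x, stepDiff x y =
          (Set.Ico y 0).indicator (1 : ℝ → ℝ) x := fun x => by
        by_cases h1 : 0 ≤ x
        · simp [stepDiff, Set.indicator, h1, h.trans h1]
        · by_cases h2 : y ≤ x <;> simp [stepDiff, Set.indicator, h1, h2, not_le.1 h1]
      simp only [e]
      rw [integral_indicator_one measurableSet_Ico]
      simp [Measure.real, h]
  rw [this]; ring

/-- Integration against a rescaled and translated function. -/
lemma integral_mul_scale {m : ℝ} (hm : 0 < m) (lam : ℝ) (G F : ℝ → ℝ) :
    ∫ x, m * G (m * (x - lam)) * F x = ∫ u, G u * F (lam + m⁻¹ * u) := by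
  have h1 := integral_sub_right_eq_self (μ := volume)
    (fun x => m * G (m * x) * F (lam + x)) lam
  have h2 := Measure.integral_comp_mul_left (fun u => m * G u * F (lam + m⁻¹ * u)) m
  simp only [add_sub_cancel] at h1
  rw [h1]
  have e : ∀ x, m * G (m * x) * F (lam + x) = m * G (m * x) * F (lam + m⁻¹ * (m * x)) := fun x => by
    rw [inv_mul_cancel_left₀ hm.ne']
  simp only [e]
  rw [h2, abs_of_pos (inv_pos.2 hm)]
  simp only [mul_assoc, integral_const_mul, smul_eq_mul]
  rw [inv_mul_cancel_left₀ hm.ne']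

lemma integrable_scale {m : ℝ} (hm : 0 < m) (lam : ℝ) {G : ℝ → ℝ} (hG : Integrable G) :
    Integrable (fun x => G (m * (x - lam))) :=
  (hG.comp_mul_left' hm.ne').comp_sub_right lam

lemma primitive_scale {m : ℝ} (hm : 0 < m) (lam : ℝ) (x : ℝ) :
    primitive (fun x => m ^ 2 * g (m * (x - lam))) x = m * primitive g (m * (x - lam)) := by
  unfold primitive
  rw [← integral_indicator measurableSet_Iic, ← integral_indicator measurableSet_Iic]
  have := integral_mul_scale hm lam ((Set.Iic (m * (x - lam))).indicator g) (fun _ => m)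
  rw [show ∫ u, (Set.Iic (m * (x - lam))).indicator g u * m =
    m * ∫ u, (Set.Iic (m * (x - lam))).indicator g u by rw [integral_mul_const, mul_comm]] at this
  rw [← this]
  congr 1
  ext y
  by_cases h : y ≤ x
  · rw [Set.indicator_of_mem (by simpa using h), Set.indicator_of_mem (by
      simp only [Set.mem_Iic]; gcongr)]
    ring
  · rw [Set.indicator_of_notMem (by simpa using h), Set.indicator_of_notMem (by
      simp only [Set.mem_Iic, not_le]
      have := not_le.1 h
      gcongr)]
    ring

lemma primitive_heatKernelDeriv {v : ℝ} (hv : 0 < v) :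
    primitive (heatKernelDeriv v) = heatKernel v := by
  ext x
  unfold primitive
  rw [integral_Iic_of_hasDerivAt_of_tendsto' (fun y _ => hasDerivAt_heatKernel hv y)
    (integrable_heatKernelDeriv hv).integrableOn
    ((tendsto_heatKernel_cocompact hv).mono_left atBot_le_cocompact)]
  ring

end Primitive

/-! ### The covariance kernels of the local time and of its derivative -/

section Moments

variable {Ω : Type*} [MeasurableSpace Ω] {H t : ℝ} {X : ℝ → Ω → ℝ} {P : Measure Ω}
  [IsProbabilityMeasure P] {g h : ℝ → ℝ}

/-- The covariance kernel of the local times `L_t(x)`, `L_t(y)`. -/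
noncomputable def localTimeKernel (H t : ℝ) : ℝ → ℝ → ℝ :=
  averagedKernel (timeSquare t) (fbmDensity H)

/-- The covariance kernel of the derivatives `L'_t(x)`, `L'_t(y)` of the local time. -/
noncomputable def localTimeDerivKernel (H t : ℝ) : ℝ → ℝ → ℝ :=
  averagedKernel (timeSquare t) (fbmDensityMixed H)

lemma HasFBMPairLaw.integral_mul_eq_localTimeKernel (hX : HasFBMPairLaw H X P) (hH0 : 0 < H)
    (hH : H < 1 / 3) (ht : 0 < t) (hg : Measurable g) (hgi : Integrable g) (hh : Measurable h)
    (hhi : Integrable h) :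
    ∫ ω, additiveFunctional X t g ω * additiveFunctional X t h ω ∂P =
      ∫ z : ℝ × ℝ, g z.1 * h z.2 * localTimeKernel H t z.1 z.2 := by
  rw [hX.integral_additiveFunctional_mul hH0 hH ht hg hgi hh hhi,
    (isDominatedKernel_fbmDensity hH0 hH ht).integral_swap hgi hhi]
  rfl

lemma HasFBMPairLaw.integral_mul_eq_localTimeDerivKernel (hX : HasFBMPairLaw H X P)
    (hH0 : 0 < H) (hH : H < 1 / 3) (ht : 0 < t) (hg : Measurable g) (hgi : Integrable g)
    (hh : Measurable h) (hhi : Integrable h) (hGi : Integrable (primitive g))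
    (hHi : Integrable (primitive h)) :
    ∫ ω, additiveFunctional X t g ω * additiveFunctional X t h ω ∂P =
      ∫ z : ℝ × ℝ, primitive g z.1 * primitive h z.2 * localTimeDerivKernel H t z.1 z.2 := by
  rw [hX.integral_additiveFunctional_mul hH0 hH ht hg hgi hh hhi]
  have hk := isDominatedKernel_fbmDensityMixed hH0 hH ht
  refine Eq.trans ?_ (hk.integral_swap hGi hHi)
  refine integral_congr_ae ?_
  filter_upwards [ae_timeSquare t] with p ⟨h1, h2, h12⟩
  have := h1.1
  exact integral_mul_pairDensity (by positivity)
    (fbmDet_pos hH0 (by linarith) h1.1 h2.1 h12) hgi hhi hGi hHi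

end Moments

/-! ### Concentration at a point -/

section Concentration

variable {K : ℝ → ℝ → ℝ} {C lam : ℝ}

lemma integrable_mul_kernel (hKc : Continuous (fun z : ℝ × ℝ => K z.1 z.2))
    (hKb : ∀ x y, |K x y| ≤ C) {G₁ G₂ : ℝ → ℝ} (h₁ : Integrable G₁) (h₂ : Integrable G₂) :
    Integrable (fun z : ℝ × ℝ => G₁ z.1 * G₂ z.2 * K z.1 z.2) :=
  (h₁.mul_prod h₂).mul_bdd hKc.aestronglyMeasurable (Eventually.of_forall fun _ => hKb _ _)

lemma integral_mul_kernel_scale (hKc : Continuous (fun z : ℝ × ℝ => K z.1 z.2))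
    (hKb : ∀ x y, |K x y| ≤ C) {G₁ G₂ : ℝ → ℝ} (h₁ : Integrable G₁) (h₂ : Integrable G₂)
    {a b : ℝ} (ha : 0 < a) (hb : 0 < b) :
    ∫ z : ℝ × ℝ, (a * G₁ (a * (z.1 - lam))) * (b * G₂ (b * (z.2 - lam))) * K z.1 z.2 =
      ∫ z : ℝ × ℝ, G₁ z.1 * G₂ z.2 * K (lam + a⁻¹ * z.1) (lam + b⁻¹ * z.2) := by
  have hK' : Continuous (fun z : ℝ × ℝ => K (lam + a⁻¹ * z.1) (lam + b⁻¹ * z.2)) :=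
    hKc.comp (f := fun z : ℝ × ℝ => (lam + a⁻¹ * z.1, lam + b⁻¹ * z.2)) (by fun_prop)
  have i1 := integrable_mul_kernel hKc hKb ((integrable_scale ha lam h₁).const_mul a)
    ((integrable_scale hb lam h₂).const_mul b)
  have i2 := integrable_mul_kernel (K := fun x y => K (lam + a⁻¹ * x) (lam + b⁻¹ * y)) hK'
    (fun _ _ => hKb _ _) h₁ h₂
  rw [Measure.volume_eq_prod] at i1 i2 ⊢
  rw [integral_prod _ i1, integral_prod _ i2]
  simp only [mul_assoc (a * _), mul_assoc (G₁ _), integral_const_mul, integral_mul_scale hb lam G₂]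
  exact integral_mul_scale ha lam G₁ (fun x => ∫ y, G₂ y * K x (lam + b⁻¹ * y))

/-- If `G₁`, `G₂` are rescaled so as to concentrate at `lam`, their pairing through `K` tends to
the product of their masses and `K lam lam`. -/
lemma tendsto_integral_mul_kernel (hKc : Continuous (fun z : ℝ × ℝ => K z.1 z.2))
    (hKb : ∀ x y, |K x y| ≤ C) {G₁ G₂ : ℝ → ℝ} (h₁ : Integrable G₁) (h₂ : Integrable G₂)
    {ι : Type*} {l : Filter ι} [l.IsCountablyGenerated] {a b : ι → ℝ}
    (ha : Tendsto a l (𝓝 0)) (hb : Tendsto b l (𝓝 0)) :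
    Tendsto (fun i => ∫ z : ℝ × ℝ, G₁ z.1 * G₂ z.2 * K (lam + a i * z.1) (lam + b i * z.2)) l
      (𝓝 ((∫ x, G₁ x) * (∫ y, G₂ y) * K lam lam)) := by
  have hG := h₁.mul_prod h₂
  rw [← integral_prod_mul, ← integral_mul_const, ← Measure.volume_eq_prod]
  refine tendsto_integral_filter_of_dominated_convergence
    (fun z : ℝ × ℝ => |G₁ z.1 * G₂ z.2| * C) ?_ ?_ (hG.abs.mul_const C) ?_
  · refine Eventually.of_forall fun i => hG.aestronglyMeasurable.mul ?_
    exact (hKc.comp (f := fun z : ℝ × ℝ => (lam + a i * z.1, lam + b i * z.2))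
      (by fun_prop)).aestronglyMeasurable
  · refine Eventually.of_forall fun i => Eventually.of_forall fun z => ?_
    rw [norm_mul]
    exact mul_le_mul_of_nonneg_left (hKb _ _) (norm_nonneg _)
  · refine Eventually.of_forall fun z => Tendsto.const_mul _ ?_
    have h1 : Tendsto (fun i => (lam + a i * z.1, lam + b i * z.2)) l (𝓝 (lam, lam)) := by
      have e1 := (ha.mul_const z.1).const_add lam
      have e2 := (hb.mul_const z.2).const_add lam
      simp only [zero_mul, add_zero] at e1 e2
      exact e1.prodMk_nhds e2
    exact (hKc.tendsto (lam, lam)).comp h1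

/-- Pairing through `K` of functions of mean zero that concentrate at a point. -/
lemma tendsto_integral_mul_kernel_zero (hKc : Continuous (fun z : ℝ × ℝ => K z.1 z.2))
    (hKb : ∀ x y, |K x y| ≤ C) {G : ℕ → ℝ → ℝ} {V : ℝ → ℝ} (hG : ∀ n, Integrable (G n))
    (hG0 : ∀ n, ∫ x, G n x = 0) (hV : Integrable V) (hGV : ∀ n x, |G n x| ≤ V x)
    {a : ℕ → ℝ} (ha : Tendsto a atTop (𝓝 0)) :
    Tendsto (fun n => ∫ z : ℝ × ℝ, G n z.1 * G n z.2 * K (lam + a n * z.1) (lam + a n * z.2))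
      atTop (𝓝 0) := by
  have hcont : ∀ n, Continuous (fun z : ℝ × ℝ => K (lam + a n * z.1) (lam + a n * z.2)) :=
    fun n => hKc.comp (f := fun z : ℝ × ℝ => (lam + a n * z.1, lam + a n * z.2)) (by fun_prop)
  have hlim : ∀ z : ℝ × ℝ,
      Tendsto (fun n => K (lam + a n * z.1) (lam + a n * z.2) - K lam lam) atTop (𝓝 0) := by
    intro z
    have h1 : Tendsto (fun i => (lam + a i * z.1, lam + a i * z.2)) atTop (𝓝 (lam, lam)) := by
      have e1 := (ha.mul_const z.1).const_add lam
      have e2 := (ha.mul_const z.2).const_add lam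
      simp only [zero_mul, add_zero] at e1 e2
      exact e1.prodMk_nhds e2
    simpa using ((hKc.tendsto (lam, lam)).comp h1).sub_const (K lam lam)
  have e : ∀ n, ∫ z : ℝ × ℝ, G n z.1 * G n z.2 * K (lam + a n * z.1) (lam + a n * z.2) =
      ∫ z : ℝ × ℝ, G n z.1 * G n z.2 *
        (K (lam + a n * z.1) (lam + a n * z.2) - K lam lam) := by
    intro n
    have i1 := integrable_mul_kernel (K := fun x y => K (lam + a n * x) (lam + a n * y)) (hcont n)
      (fun _ _ => hKb _ _) (hG n) (hG n)
    have i2 := ((hG n).mul_prod (hG n)).mul_const (K lam lam)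
    have e0 : ∫ z : ℝ × ℝ, G n z.1 * G n z.2 * K lam lam = 0 := by
      rw [integral_mul_const, Measure.volume_eq_prod, integral_prod_mul, hG0]
      simp
    simp only [mul_sub]
    rw [integral_sub i1 i2, e0, sub_zero]
  simp only [e]
  have := tendsto_integral_of_dominated_convergence (F := fun n (z : ℝ × ℝ) =>
    G n z.1 * G n z.2 * (K (lam + a n * z.1) (lam + a n * z.2) - K lam lam)) (f := fun _ => 0)
    (fun z : ℝ × ℝ => V z.1 * V z.2 * (C + C)) (μ := volume) ?_ ?_ ?_ ?_
  · simpa using this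
  · exact fun n => ((hG n).mul_prod (hG n)).aestronglyMeasurable.mul
      ((hcont n).sub continuous_const).aestronglyMeasurable
  · exact (hV.mul_prod hV).mul_const _
  · intro n
    refine Eventually.of_forall fun z => ?_
    rw [norm_mul, norm_mul]
    have hV1 := (abs_nonneg _).trans (hGV n z.1)
    have hV2 := (abs_nonneg _).trans (hGV n z.2)
    exact mul_le_mul (mul_le_mul (hGV n _) (hGV n _) (abs_nonneg _) hV1)
      ((abs_sub _ _).trans (add_le_add (hKb _ _) (hKb _ _))) (norm_nonneg _) (by positivity)
  · refine Eventually.of_forall fun z => ?_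
    have h2 := ((hlim z).abs.const_mul (V z.1 * V z.2))
    simp only [abs_zero, mul_zero] at h2
    refine squeeze_zero_norm (fun n => ?_) h2
    have hV1 := (abs_nonneg _).trans (hGV n z.1)
    rw [norm_mul, norm_mul]
    exact mul_le_mul_of_nonneg_right
      (mul_le_mul (hGV n _) (hGV n _) (abs_nonneg _) hV1) (norm_nonneg _)

/-- Pairing through `K` of two heat kernels concentrating at `lam`. -/
lemma tendsto_integral_heatKernel_mul (hKc : Continuous (fun z : ℝ × ℝ => K z.1 z.2))
    (hKb : ∀ x y, |K x y| ≤ C) :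
    Tendsto (fun e : ℝ × ℝ => ∫ z : ℝ × ℝ,
      heatKernel e.1 (z.1 - lam) * heatKernel e.2 (z.2 - lam) * K z.1 z.2)
      (𝓝[>] 0 ×ˢ 𝓝[>] 0) (𝓝 (K lam lam)) := by
  have hi := integrable_heatKernel one_pos
  have hs : Tendsto (fun x : ℝ => √x) (𝓝[>] 0) (𝓝 0) := by
    have := (Real.continuous_sqrt.tendsto 0).mono_left (nhdsWithin_le_nhds (s := Set.Ioi 0))
    simpa using this
  have := tendsto_integral_mul_kernel (lam := lam) hKc hKb hi hi
    (hs.comp (tendsto_fst (f := 𝓝[>] (0 : ℝ)) (g := 𝓝[>] (0 : ℝ)))) (hs.comp tendsto_snd)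
  simp only [integral_heatKernel one_pos, one_mul] at this
  refine this.congr' ?_
  have hpos : ∀ᶠ e : ℝ × ℝ in 𝓝[>] 0 ×ˢ 𝓝[>] 0, 0 < e.1 ∧ 0 < e.2 :=
    (tendsto_fst.eventually eventually_mem_nhdsWithin).and
      (tendsto_snd.eventually eventually_mem_nhdsWithin)
  filter_upwards [hpos] with e he
  have h1 := inv_pos.2 (Real.sqrt_pos.2 he.1)
  have h2 := inv_pos.2 (Real.sqrt_pos.2 he.2)
  have := integral_mul_kernel_scale (lam := lam) hKc hKb hi hi h1 h2
  simp only [inv_inv, ← heatKernel_eq_scale_one he.1, ← heatKernel_eq_scale_one he.2] at this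
  simp only [Function.comp]
  exact this.symm

end Concentration

/-! ### Convergence in `L²` -/

/-- In a Hilbert space, a family converges as soon as its Gram matrix does. -/
lemma exists_tendsto_of_tendsto_inner {E : Type*} [NormedAddCommGroup E] [InnerProductSpace ℝ E]
    [CompleteSpace E] {ι : Type*} {l : Filter ι} [l.NeBot] {F : ι → E} {c : ℝ}
    (h : Tendsto (fun p : ι × ι => inner ℝ (F p.1) (F p.2)) (l ×ˢ l) (𝓝 c)) :
    ∃ y, Tendsto F l (𝓝 y) := by
  have hd : Tendsto (fun i => inner ℝ (F i) (F i)) l (𝓝 c) :=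
    h.comp (tendsto_id.prodMk tendsto_id)
  have h1 : Tendsto (fun p : ι × ι => ‖F p.1 - F p.2‖ ^ 2) (l ×ˢ l) (𝓝 0) := by
    have := ((hd.comp tendsto_fst).sub (h.const_mul 2)).add
      (hd.comp (tendsto_snd (f := l) (g := l)))
    rw [show c - 2 * c + c = 0 by ring] at this
    refine this.congr fun p => ?_
    simp only [Function.comp, real_inner_self_eq_norm_sq]
    rw [norm_sub_sq_real]
  have h2 : Tendsto (fun p : ι × ι => ‖F p.1 - F p.2‖) (l ×ˢ l) (𝓝 0) := by
    have := h1.sqrt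
    simpa [Real.sqrt_sq] using this
  refine CompleteSpace.complete (f := map F l) ⟨inferInstance, ?_⟩
  rw [Metric.uniformity_eq_comap_nhds_zero, ← tendsto_iff_comap, prod_map_map_eq, tendsto_map'_iff]
  simpa [Function.comp_def, dist_eq_norm] using h2

section L2

variable {Ω : Type*} [MeasurableSpace Ω] {P : Measure Ω} {ι : Type*} {l : Filter ι}

lemma eLpNorm_two_eq {Y : Ω → ℝ} (hY : MemLp Y 2 P) :
    eLpNorm Y 2 P = ENNReal.ofReal √(∫ ω, Y ω * Y ω ∂P) := by
  rw [hY.eLpNorm_eq_integral_rpow_norm (by simp) (by simp), Real.sqrt_eq_rpow]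
  simp [← pow_two]

lemma TendstoInL2.congr {X X' : ι → Ω → ℝ} {Y : Ω → ℝ} (h : TendstoInL2 P X l Y)
    (hX : ∀ᶠ i in l, X i =ᵐ[P] X' i) : TendstoInL2 P X' l Y := by
  refine ⟨?_, h.2.1, h.2.2.congr' ?_⟩
  · filter_upwards [h.1, hX] with i hi hXi using (memLp_congr_ae hXi).1 hi
  · filter_upwards [hX] with i hXi using eLpNorm_congr_ae (hXi.sub EventuallyEq.rfl)

/-- A family of square integrable variables converges in `L²` as soon as its second moments do. -/
lemma exists_tendstoInL2 [l.NeBot] {Y : ι → Ω → ℝ} (hY : ∀ᶠ i in l, MemLp (Y i) 2 P) {c : ℝ}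
    (h : Tendsto (fun p : ι × ι => ∫ ω, Y p.1 ω * Y p.2 ω ∂P) (l ×ˢ l) (𝓝 c)) :
    ∃ Z, TendstoInL2 P Y l Z := by
  classical
  let F : ι → Lp ℝ 2 P := fun i => if hi : MemLp (Y i) 2 P then hi.toLp else 0
  have hF : ∀ i, MemLp (Y i) 2 P → F i =ᵐ[P] Y i := fun i hi => by
    simp only [F, hi, dif_pos]; exact hi.coeFn_toLp
  have hin : Tendsto (fun p : ι × ι => inner ℝ (F p.1) (F p.2)) (l ×ˢ l) (𝓝 c) := by
    refine h.congr' ?_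
    filter_upwards [(tendsto_fst (f := l) (g := l)).eventually hY, tendsto_snd.eventually hY]
      with p h1 h2
    rw [L2.inner_def]
    refine integral_congr_ae ?_
    filter_upwards [hF _ h1, hF _ h2] with ω e1 e2
    simp [e1, e2, mul_comm]
  obtain ⟨y, hy⟩ := exists_tendsto_of_tendsto_inner hin
  refine ⟨y, hY, Lp.memLp y, ?_⟩
  have := tendsto_iff_edist_tendsto_0.1 hy
  refine this.congr' ?_
  filter_upwards [hY] with i hi
  rw [Lp.edist_def]
  exact eLpNorm_congr_ae ((hF i hi).sub EventuallyEq.rfl)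

/-- A variance `δ / m ^ 2` with `δ ≤ 1` at which the family is within `η` of its limit, even after
multiplication by `c`. -/
lemma TendstoInL2.exists_scaled_le {Y : ℝ → Ω → ℝ} {L : Ω → ℝ}
    (hL : TendstoInL2 P Y (𝓝[>] 0) L) {m : ℝ} (hm : 0 < m) (c : ℝ) {η : ℝ≥0∞} (hη : 0 < η) :
    ∃ δ, 0 < δ ∧ δ ≤ 1 ∧ MemLp (Y (δ / m ^ 2)) 2 P ∧
      eLpNorm (fun ω => c * (Y (δ / m ^ 2) ω - L ω)) 2 P ≤ η := by
  have hs : Tendsto (fun δ : ℝ => δ / m ^ 2) (𝓝[>] 0) (𝓝[>] 0) := by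
    refine tendsto_nhdsWithin_iff.2 ⟨?_, ?_⟩
    · have : Tendsto (fun δ : ℝ => δ / m ^ 2) (𝓝 0) (𝓝 (0 / m ^ 2)) := tendsto_id.div_const _
      rw [zero_div] at this
      exact this.mono_left nhdsWithin_le_nhds
    · filter_upwards [self_mem_nhdsWithin] with δ hδ
      exact Set.mem_Ioi.2 (div_pos (Set.mem_Ioi.1 hδ) (by positivity))
  have h1 : Tendsto (fun δ : ℝ => eLpNorm (fun ω => c * (Y (δ / m ^ 2) ω - L ω)) 2 P)
      (𝓝[>] 0) (𝓝 0) := by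
    have := ENNReal.Tendsto.const_mul (a := ‖c‖ₑ) (hL.2.2.comp hs) (Or.inr enorm_ne_top)
    rw [mul_zero] at this
    refine this.congr fun δ => ?_
    exact (eLpNorm_const_smul c (fun ω => Y (δ / m ^ 2) ω - L ω) 2 P).symm
  have h2 : ∀ᶠ δ : ℝ in 𝓝[>] 0, δ ≤ 1 :=
    nhdsWithin_le_nhds (eventually_le_nhds one_pos)
  obtain ⟨δ, hδ0, hδ1, hδ2, hδ3⟩ := ((eventually_mem_nhdsWithin (a := (0 : ℝ))
    (s := Set.Ioi 0)).and (h2.and ((hs.eventually hL.1).and (h1.eventually_le_const hη)))).exists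
  exact ⟨δ, hδ0, hδ1, hδ2, hδ3⟩

end L2

/-! ### Existence of the local time and of its derivative -/

section LocalTime

variable {Ω : Type*} [MeasurableSpace Ω] {H t lam : ℝ} {X : ℝ → Ω → ℝ} {P : Measure Ω}
  [IsProbabilityMeasure P]

lemma HasFBMPairLaw.exists_localTime (hX : HasFBMPairLaw H X P) (hH0 : 0 < H)
    (hH : H < 1 / 3) (ht : 0 < t) (lam : ℝ) :
    ∃ L, TendstoInL2 P (fun ε => additiveFunctional X t (fun x => heatKernel ε (x - lam)))
      (𝓝[>] 0) L := by
  have hk := isDominatedKernel_fbmDensity hH0 hH ht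
  obtain ⟨C, hC⟩ := hk.exists_bound_averagedKernel
  have hm : ∀ ε, Measurable (fun x => heatKernel ε (x - lam)) := fun ε =>
    ((continuous_heatKernel ε).comp (by fun_prop)).measurable
  have hi : ∀ ε, 0 < ε → Integrable (fun x => heatKernel ε (x - lam)) := fun ε hε =>
    (integrable_heatKernel hε).comp_sub_right lam
  have hpos : ∀ᶠ ε : ℝ in 𝓝[>] 0, 0 < ε := eventually_mem_nhdsWithin
  refine exists_tendstoInL2 ?_ ((tendsto_integral_heatKernel_mul (lam := lam)
    hk.continuous_averagedKernel hC).congr' ?_)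
  · filter_upwards [hpos] with ε hε
    exact hX.memLp_additiveFunctional hH0 hH ht (hm ε) (hi ε hε)
  · filter_upwards [hpos.prod_mk hpos] with e he
    exact (hX.integral_mul_eq_localTimeKernel hH0 hH ht (hm _) (hi _ he.1) (hm _)
      (hi _ he.2)).symm

lemma primitive_heatKernelDeriv_sub {ε : ℝ} (hε : 0 < ε) (lam : ℝ) :
    primitive (fun x => heatKernelDeriv ε (x - lam)) = fun x => heatKernel ε (x - lam) := by
  ext x
  have h := primitive_scale (g := heatKernelDeriv ε) one_pos lam x
  simpa [primitive_heatKernelDeriv hε] using h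

lemma HasFBMPairLaw.exists_localTimeDeriv (hX : HasFBMPairLaw H X P) (hH0 : 0 < H)
    (hH : H < 1 / 3) (ht : 0 < t) (lam : ℝ) :
    ∃ L, TendstoInL2 P
      (fun ε => additiveFunctional X t (fun x => -heatKernelDeriv ε (x - lam))) (𝓝[>] 0) L := by
  have hk := isDominatedKernel_fbmDensityMixed hH0 hH ht
  obtain ⟨C, hC⟩ := hk.exists_bound_averagedKernel
  have hm : ∀ ε, Measurable (fun x => heatKernelDeriv ε (x - lam)) := fun ε =>
    ((continuous_heatKernelDeriv ε).comp (by fun_prop)).measurable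
  have hi : ∀ ε, 0 < ε → Integrable (fun x => heatKernelDeriv ε (x - lam)) := fun ε hε =>
    (integrable_heatKernelDeriv hε).comp_sub_right lam
  have hp : ∀ ε, 0 < ε → Integrable (primitive fun x => heatKernelDeriv ε (x - lam)) := by
    intro ε hε
    rw [primitive_heatKernelDeriv_sub hε]
    exact (integrable_heatKernel hε).comp_sub_right lam
  have hpos : ∀ᶠ ε : ℝ in 𝓝[>] 0, 0 < ε := eventually_mem_nhdsWithin
  refine exists_tendstoInL2 ?_ ((tendsto_integral_heatKernel_mul (lam := lam)
    hk.continuous_averagedKernel hC).congr' ?_)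
  · filter_upwards [hpos] with ε hε
    exact hX.memLp_additiveFunctional hH0 hH ht (hm ε).neg (hi ε hε).neg
  · filter_upwards [hpos.prod_mk hpos] with e he
    have := hX.integral_mul_eq_localTimeDerivKernel hH0 hH ht (hm _) (hi _ he.1) (hm _)
      (hi _ he.2) (hp _ he.1) (hp _ he.2)
    simp only [primitive_heatKernelDeriv_sub he.1, primitive_heatKernelDeriv_sub he.2] at this
    simp only [additiveFunctional, integral_neg, neg_mul_neg] at this ⊢
    exact this.symm

/-- Additive functionals of functions that concentrate at `lam` and whose first two moments vanish
are asymptotically negligible at the scale of the derivative of the local time. -/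
lemma HasFBMPairLaw.tendsto_eLpNorm_scale (hX : HasFBMPairLaw H X P) (hH0 : 0 < H)
    (hH : H < 1 / 3) (ht : 0 < t) {g : ℕ → ℝ → ℝ} {V : ℝ → ℝ} {m : ℕ → ℝ}
    (hgm : ∀ n, Measurable (g n)) (hg : ∀ n, Integrable (g n))
    (hg1 : ∀ n, Integrable (fun y => y * g n y)) (h0 : ∀ n, ∫ y, g n y = 0)
    (h1 : ∀ n, ∫ y, y * g n y = 0) (hV : Integrable V) (hgV : ∀ n x, tailMass (g n) x ≤ V x)
    (hm0 : ∀ n, 0 < m n) (hm : Tendsto m atTop atTop) :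
    Tendsto (fun n => eLpNorm
      (additiveFunctional X t fun x => m n ^ 2 * g n (m n * (x - lam))) 2 P) atTop (𝓝 0) := by
  have hk := isDominatedKernel_fbmDensityMixed hH0 hH ht
  obtain ⟨C, hC⟩ := hk.exists_bound_averagedKernel
  have hGi : ∀ n, Integrable (primitive (g n)) := fun n =>
    integrable_primitive (hg n) (hg1 n) (h0 n)
  have hlim := tendsto_integral_mul_kernel_zero (lam := lam) hk.continuous_averagedKernel hC hGi
    (fun n => by rw [integral_primitive (hg n) (hg1 n) (h0 n), h1, neg_zero]) hV
    (fun n x => (abs_primitive_le_tailMass (hg n) (h0 n) x).trans (hgV n x))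
    (tendsto_inv_atTop_zero.comp hm)
  have hsm : ∀ n, Measurable (fun x => m n ^ 2 * g n (m n * (x - lam))) := fun n =>
    ((hgm n).comp (by fun_prop)).const_mul _
  have hsi : ∀ n, Integrable (fun x => m n ^ 2 * g n (m n * (x - lam))) := fun n =>
    (integrable_scale (hm0 n) lam (hg n)).const_mul _
  have hpe : ∀ n, primitive (fun x => m n ^ 2 * g n (m n * (x - lam))) =
      fun x => m n * primitive (g n) (m n * (x - lam)) := fun n =>
    funext fun x => primitive_scale (hm0 n) lam x
  have hpi : ∀ n, Integrable (primitive fun x => m n ^ 2 * g n (m n * (x - lam))) := fun n => by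
    rw [hpe]; exact (integrable_scale (hm0 n) lam (hGi n)).const_mul _
  have e : ∀ n, eLpNorm (additiveFunctional X t fun x => m n ^ 2 * g n (m n * (x - lam))) 2 P =
      ENNReal.ofReal √(∫ z : ℝ × ℝ, primitive (g n) z.1 * primitive (g n) z.2 *
        localTimeDerivKernel H t (lam + (m n)⁻¹ * z.1) (lam + (m n)⁻¹ * z.2)) := fun n => by
    rw [eLpNorm_two_eq (hX.memLp_additiveFunctional hH0 hH ht (hsm n) (hsi n)),
      hX.integral_mul_eq_localTimeDerivKernel hH0 hH ht (hsm n) (hsi n) (hsm n) (hsi n) (hpi n)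
      (hpi n), hpe,
      integral_mul_kernel_scale (K := localTimeDerivKernel H t) hk.continuous_averagedKernel hC
      (hGi n) (hGi n) (hm0 n) (hm0 n)]
  simp only [e]
  have := ENNReal.tendsto_ofReal hlim.sqrt
  rw [Real.sqrt_zero, ENNReal.ofReal_zero] at this
  exact this

/-! ### Tails and moments of the heat kernel -/

lemma tailMass_mono_of_abs_le {g : ℝ → ℝ} (hg : Integrable g) {x x' : ℝ} (h : |x| ≤ |x'|) :
    tailMass g x' ≤ tailMass g x :=
  setIntegral_mono_set hg.abs.integrableOn (Eventually.of_forall fun _ => abs_nonneg _)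
    (Eventually.of_forall fun _ hy => h.trans hy)

lemma tailMass_add_le {g h : ℝ → ℝ} (hg : Integrable g) (hh : Integrable h) (x : ℝ) :
    tailMass (fun y => g y + h y) x ≤ tailMass g x + tailMass h x := by
  unfold tailMass
  rw [← integral_add hg.abs.integrableOn hh.abs.integrableOn]
  exact integral_mono (hg.add hh).abs.integrableOn (hg.abs.add hh.abs).integrableOn
    fun y => abs_add_le _ _

lemma tailMass_const_mul (c : ℝ) (g : ℝ → ℝ) (x : ℝ) :
    tailMass (fun y => c * g y) x = |c| * tailMass g x := by
  simp only [tailMass, abs_mul, integral_const_mul]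

/-- A Gaussian of variance at most one has smaller tails than the standard Gaussian. -/
lemma tailMass_heatKernel_le {v : ℝ} (hv : 0 < v) (hv1 : v ≤ 1) (x : ℝ) :
    tailMass (heatKernel v) x ≤ tailMass (heatKernel 1) x := by
  have hs := Real.sqrt_pos.2 hv
  have hs1 : √v ≤ 1 := Real.sqrt_le_one.2 hv1
  have e : tailMass (heatKernel v) x = tailMass (heatKernel 1) ((√v)⁻¹ * x) := by
    unfold tailMass
    rw [← integral_indicator (measurableSet_abs_ge _),
      ← integral_indicator (measurableSet_abs_ge _)]
    have := integral_mul_scale (inv_pos.2 hs) 0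
      ({y : ℝ | |(√v)⁻¹ * x| ≤ |y|}.indicator fun y => |heatKernel 1 y|) (fun _ => 1)
    simp only [mul_one, sub_zero] at this
    rw [← this]
    congr 1
    ext y
    have hiff : |(√v)⁻¹ * x| ≤ |(√v)⁻¹ * y| ↔ |x| ≤ |y| := by
      rw [abs_mul, abs_mul, mul_le_mul_iff_right₀ (abs_pos.2 (inv_pos.2 hs).ne')]
    by_cases h : |x| ≤ |y|
    · rw [Set.indicator_of_mem (by exact h), Set.indicator_of_mem (by exact hiff.2 h),
        heatKernel_eq_scale_one hv, abs_mul, abs_of_pos (inv_pos.2 hs)]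
    · rw [Set.indicator_of_notMem (by exact h),
        Set.indicator_of_notMem (by exact fun h' => h (hiff.1 h')), mul_zero]
  rw [e]
  refine tailMass_mono_of_abs_le (integrable_heatKernel one_pos) ?_
  rw [abs_mul, abs_of_pos (inv_pos.2 hs)]
  exact le_mul_of_one_le_left (abs_nonneg _) ((one_le_inv₀ hs).2 hs1)

lemma integrable_id_mul_heatKernel {v : ℝ} (hv : 0 < v) :
    Integrable (fun y => y * heatKernel v y) := by
  simpa using integrable_pow_mul_heatKernel hv 1

lemma integral_id_mul_heatKernel (v : ℝ) : ∫ y, y * heatKernel v y = 0 := by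
  have h := integral_neg_eq_self (fun y => y * heatKernel v y) volume
  simp only [heatKernel_neg, neg_mul, integral_neg] at h
  linarith

lemma integrable_id_mul_heatKernelDeriv {v : ℝ} (hv : 0 < v) :
    Integrable (fun y => y * heatKernelDeriv v y) := by
  refine ((integrable_pow_mul_heatKernel hv 2).const_mul (-(1 / v))).congr
    (Eventually.of_forall fun x => ?_)
  simp only [heatKernelDeriv]; ring

lemma integral_heatKernelDeriv {v : ℝ} (hv : 0 < v) : ∫ y, heatKernelDeriv v y = 0 := by
  rw [integral_of_hasDerivAt_of_tendsto (fun y => hasDerivAt_heatKernel hv y)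
    (integrable_heatKernelDeriv hv)
    ((tendsto_heatKernel_cocompact hv).mono_left atBot_le_cocompact)
    ((tendsto_heatKernel_cocompact hv).mono_left atTop_le_cocompact), sub_zero]

lemma integral_id_mul_heatKernelDeriv {v : ℝ} (hv : 0 < v) :
    ∫ y, y * heatKernelDeriv v y = -1 := by
  have h := integral_primitive (integrable_heatKernelDeriv hv)
    (integrable_id_mul_heatKernelDeriv hv) (integral_heatKernelDeriv hv)
  rw [primitive_heatKernelDeriv hv, integral_heatKernel hv] at h
  linarith

end LocalTime

/-! ### The limit theorem -/

section LimitTheorem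

variable {Ω : Type*} [MeasurableSpace Ω] {H t lam : ℝ} {X : ℝ → Ω → ℝ} {P : Measure Ω}
  [IsProbabilityMeasure P] {f : ℝ → ℝ}

/-- The limit theorem for a process with the two-dimensional laws of fractional Brownian motion.
The function `f` is compensated by `(∫ f) p_δ` and `(∫ y f) p_1'`, which removes its moments of
order zero and one; the variance `δ` is chosen at each step so small that the mollified local time
is closer to the local time than the scale `1 / m n` of the fluctuations. -/
lemma HasFBMPairLaw.tendsto_eLpNorm_sub (hX : HasFBMPairLaw H X P) (hH0 : 0 < H)
    (hH : H < 1 / 3) (ht : 0 < t) (hf : Measurable f) (hfi : Integrable f)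
    (hf1 : Integrable (fun y => y * f y)) {L L' : Ω → ℝ}
    (hL : TendstoInL2 P (fun ε => additiveFunctional X t (fun x => heatKernel ε (x - lam)))
      (𝓝[>] 0) L)
    (hL' : TendstoInL2 P
      (fun ε => additiveFunctional X t (fun x => -heatKernelDeriv ε (x - lam))) (𝓝[>] 0) L')
    {m : ℕ → ℝ} (hm0 : ∀ n, 0 < m n) (hm : Tendsto m atTop atTop) :
    Tendsto (fun n => eLpNorm (fun ω => m n *
      (m n * additiveFunctional X t (fun x => f (m n * (x - lam))) ω - L ω * ∫ y, f y)
        - L' ω * ∫ y, y * f y) 2 P) atTop (𝓝 0) := by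
  set c := ∫ y, f y with hc
  set c₁ := ∫ y, y * f y with hc₁
  have hη : ∀ n : ℕ, 0 < ((n : ℝ≥0∞))⁻¹ := fun n =>
    ENNReal.inv_pos.2 (ENNReal.natCast_ne_top n)
  choose δ hδ0 hδ1 hδm hδ using fun n => hL.exists_scaled_le (hm0 n) (m n * c) (hη n)
  let g : ℕ → ℝ → ℝ := fun n y => f y + (-c * heatKernel (δ n) y + c₁ * heatKernelDeriv 1 y)
  have hp := fun n => integrable_heatKernel (hδ0 n)
  have hd := integrable_heatKernelDeriv one_pos
  have hp1 := fun n => integrable_id_mul_heatKernel (hδ0 n)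
  have hd1 := integrable_id_mul_heatKernelDeriv one_pos
  have hgm : ∀ n, Measurable (g n) := fun n =>
    hf.add (((continuous_heatKernel _).measurable.const_mul _).add
      ((continuous_heatKernelDeriv _).measurable.const_mul _))
  have hpd : ∀ n, Integrable (fun y => -c * heatKernel (δ n) y + c₁ * heatKernelDeriv 1 y) :=
    fun n => ((hp n).const_mul _).add (hd.const_mul _)
  have hpd1 : ∀ n, Integrable (fun y => -c * (y * heatKernel (δ n) y) +
      c₁ * (y * heatKernelDeriv 1 y)) :=
    fun n => ((hp1 n).const_mul _).add (hd1.const_mul _)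
  have hg : ∀ n, Integrable (g n) := fun n => hfi.add (hpd n)
  have eg1 : ∀ n, (fun y => y * g n y) = fun y => y * f y + (-c * (y * heatKernel (δ n) y) +
      c₁ * (y * heatKernelDeriv 1 y)) := fun n => by
    ext y; simp only [g]; ring
  have hg1 : ∀ n, Integrable (fun y => y * g n y) := fun n => by
    rw [eg1]; exact hf1.add (hpd1 n)
  have h0 : ∀ n, ∫ y, g n y = 0 := fun n => by
    simp only [g]
    rw [integral_add hfi (hpd n), integral_add ((hp n).const_mul _) (hd.const_mul _),
      integral_const_mul, integral_const_mul, integral_heatKernel (hδ0 n),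
      integral_heatKernelDeriv one_pos, ← hc]
    ring
  have h1 : ∀ n, ∫ y, y * g n y = 0 := fun n => by
    rw [eg1, integral_add hf1 (hpd1 n), integral_add ((hp1 n).const_mul _) (hd1.const_mul _),
      integral_const_mul, integral_const_mul, integral_id_mul_heatKernel,
      integral_id_mul_heatKernelDeriv one_pos, ← hc₁]
    ring
  have hV : Integrable (fun x => tailMass f x + (|-c| * tailMass (heatKernel 1) x +
      |c₁| * tailMass (heatKernelDeriv 1) x)) :=
    (integrable_tailMass hfi hf1).add (((integrable_tailMass (integrable_heatKernel one_pos)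
      (integrable_id_mul_heatKernel one_pos)).const_mul _).add
      ((integrable_tailMass hd hd1).const_mul _))
  have hgV : ∀ n x, tailMass (g n) x ≤ tailMass f x + (|-c| * tailMass (heatKernel 1) x +
      |c₁| * tailMass (heatKernelDeriv 1) x) := fun n x => by
    refine (tailMass_add_le hfi (hpd n) x).trans (add_le_add le_rfl ?_)
    refine (tailMass_add_le ((hp n).const_mul _) (hd.const_mul _) x).trans ?_
    rw [tailMass_const_mul, tailMass_const_mul]
    gcongr
    exact tailMass_heatKernel_le (hδ0 n) (hδ1 n) x
  have lim1 := hX.tendsto_eLpNorm_scale (lam := lam) hH0 hH ht hgm hg hg1 h0 h1 hV hgV hm0 hm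
  have lim2 : Tendsto (fun n => eLpNorm (fun ω => m n * c *
      (additiveFunctional X t (fun x => heatKernel (δ n / m n ^ 2) (x - lam)) ω - L ω)) 2 P)
      atTop (𝓝 0) :=
    tendsto_of_tendsto_of_tendsto_of_le_of_le tendsto_const_nhds
      ENNReal.tendsto_inv_nat_nhds_zero (fun _ => zero_le) hδ
  have hsq : Tendsto (fun n => 1 / m n ^ 2) atTop (𝓝[>] 0) := by
    refine tendsto_nhdsWithin_iff.2 ⟨?_, Eventually.of_forall fun n => ?_⟩
    · simp only [one_div]
      exact tendsto_inv_atTop_zero.comp ((tendsto_pow_atTop two_ne_zero).comp hm)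
    · have := hm0 n
      exact Set.mem_Ioi.2 (by positivity)
  have lim3 : Tendsto (fun n => eLpNorm (fun ω => c₁ * (additiveFunctional X t
      (fun x => -heatKernelDeriv (1 / m n ^ 2) (x - lam)) ω - L' ω)) 2 P) atTop (𝓝 0) := by
    have := ENNReal.Tendsto.const_mul (a := ‖c₁‖ₑ) (hL'.2.2.comp hsq) (Or.inr enorm_ne_top)
    rw [mul_zero] at this
    refine this.congr fun n => ?_
    exact (eLpNorm_const_smul c₁ (fun ω => additiveFunctional X t
      (fun x => -heatKernelDeriv (1 / m n ^ 2) (x - lam)) ω - L' ω) 2 P).symm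
  have lim := (lim1.add lim2).add lim3
  simp only [add_zero] at lim
  refine tendsto_of_tendsto_of_tendsto_of_le_of_le' tendsto_const_nhds lim
    (Eventually.of_forall fun _ => zero_le) ?_
  filter_upwards [hsq.eventually hL'.1] with n hn
  have hfs := integrable_scale (hm0 n) lam hfi
  have hps : ∀ {v : ℝ}, 0 < v → Integrable (fun x => heatKernel v (x - lam)) := fun hv =>
    (integrable_heatKernel hv).comp_sub_right lam
  have hds : ∀ {v : ℝ}, 0 < v → Integrable (fun x => heatKernelDeriv v (x - lam)) := fun hv =>
    (integrable_heatKernelDeriv hv).comp_sub_right lam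
  have hmn := hm0 n
  have hv1 : 0 < δ n / m n ^ 2 := div_pos (hδ0 n) (by positivity)
  have hv2 : 0 < 1 / m n ^ 2 := by positivity
  have a1 := hX.ae_integrableOn hH0 hH ht (g := fun x => f (m n * (x - lam)))
    (hf.comp (by fun_prop)) hfs
  have a2 := hX.ae_integrableOn hH0 hH ht (g := fun x => heatKernel (δ n / m n ^ 2) (x - lam))
    ((continuous_heatKernel _).measurable.comp (by fun_prop)) (hps hv1)
  have a3 := hX.ae_integrableOn hH0 hH ht (g := fun x => heatKernelDeriv (1 / m n ^ 2) (x - lam))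
    ((continuous_heatKernelDeriv _).measurable.comp (by fun_prop)) (hds hv2)
  have eg : ∀ x, m n ^ 2 * g n (m n * (x - lam)) = m n ^ 2 * f (m n * (x - lam)) +
      (-(m n * c) * heatKernel (δ n / m n ^ 2) (x - lam) +
        c₁ * heatKernelDeriv (1 / m n ^ 2) (x - lam)) := fun x => by
    rw [heatKernel_scale hmn, heatKernelDeriv_scale hmn]
    simp only [g]; ring
  have m1 : AEStronglyMeasurable (additiveFunctional X t
      fun x => m n ^ 2 * g n (m n * (x - lam))) P :=
    (hX.memLp_additiveFunctional hH0 hH ht (((hgm n).comp (by fun_prop)).const_mul _)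
      ((integrable_scale hmn lam (hg n)).const_mul _)).aestronglyMeasurable
  have m2 : AEStronglyMeasurable (fun ω => m n * c * (additiveFunctional X t
      (fun x => heatKernel (δ n / m n ^ 2) (x - lam)) ω - L ω)) P :=
    ((hδm n).sub hL.2.1).aestronglyMeasurable.const_mul _
  have m3 : AEStronglyMeasurable (fun ω => c₁ * (additiveFunctional X t
      (fun x => -heatKernelDeriv (1 / m n ^ 2) (x - lam)) ω - L' ω)) P :=
    (hn.sub hL'.2.1).aestronglyMeasurable.const_mul _
  refine le_trans (le_of_eq ?_) ((eLpNorm_add_le (m1.add m2) m3 one_le_two).trans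
    (add_le_add (eLpNorm_add_le m1 m2 one_le_two) le_rfl))
  refine eLpNorm_congr_ae ?_
  filter_upwards [a1, a2, a3] with ω i1 i2 i3
  have i1' : Integrable (fun s => m n ^ 2 * f (m n * (X s ω - lam)))
    (volume.restrict (Set.Ioc 0 t)) := i1.integrable.const_mul _
  have i2' : Integrable (fun s => -(m n * c) * heatKernel (δ n / m n ^ 2) (X s ω - lam))
    (volume.restrict (Set.Ioc 0 t)) := i2.integrable.const_mul _
  have i3' : Integrable (fun s => c₁ * heatKernelDeriv (1 / m n ^ 2) (X s ω - lam))
    (volume.restrict (Set.Ioc 0 t)) := i3.integrable.const_mul _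
  have i23 : Integrable (fun s => -(m n * c) * heatKernel (δ n / m n ^ 2) (X s ω - lam) +
    c₁ * heatKernelDeriv (1 / m n ^ 2) (X s ω - lam)) (volume.restrict (Set.Ioc 0 t)) :=
    i2'.add i3'
  simp only [Pi.add_apply, additiveFunctional, eg]
  rw [integral_add i1' i23, integral_add i2' i3']
  simp only [integral_const_mul, integral_neg]
  ring

end LimitTheorem

/-! ### A jointly measurable version of fractional Brownian motion -/

section Modification

variable {Ω : Type*} [MeasurableSpace Ω] {H : ℝ} {B : ℝ≥0 → Ω → ℝ} {P : Measure Ω}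

/-- A process with almost surely continuous paths is indistinguishable from a jointly measurable
one. -/
lemma exists_measurable_indistinguishable (hm : ∀ t, AEMeasurable (B t) P)
    (hc : ∀ᵐ ω ∂P, Continuous (fun t => B t ω)) :
    ∃ Y : ℝ≥0 → Ω → ℝ, Measurable (fun z : ℝ≥0 × Ω => Y z.1 z.2) ∧
      ∀ᵐ ω ∂P, ∀ t, B t ω = Y t ω := by
  classical
  let q := TopologicalSpace.denseSeq ℝ≥0
  have hq : DenseRange q := TopologicalSpace.denseRange_denseSeq ℝ≥0
  have hgood : ∀ᵐ ω ∂P, Continuous (fun t => B t ω) ∧ ∀ i, B (q i) ω = (hm (q i)).mk _ ω :=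
    hc.and (ae_all_iff.2 fun i => (hm (q i)).ae_eq_mk)
  obtain ⟨N, hN, hNm, hN0⟩ := exists_measurable_superset_of_null (ae_iff.1 hgood)
  have hS : ∀ ω, ω ∉ N → Continuous (fun t => B t ω) ∧ ∀ i, B (q i) ω = (hm (q i)).mk _ ω :=
    fun ω hω => by
      by_contra h
      exact hω (hN h)
  let Y : ℝ≥0 → Ω → ℝ := fun t ω => if ω ∈ N then 0 else B t ω
  have hYc : ∀ ω, Continuous (fun t => Y t ω) := fun ω => by
    by_cases h : ω ∈ N
    · simpa [Y, h] using continuous_const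
    · simpa [Y, h] using (hS ω h).1
  have hYq : ∀ i, Measurable (Y (q i)) := fun i => by
    have : Y (q i) = fun ω => if ω ∈ N then 0 else (hm (q i)).mk _ ω := by
      ext ω
      by_cases h : ω ∈ N
      · simp [Y, h]
      · simp [Y, h, (hS ω h).2 i]
    rw [this]
    exact Measurable.ite hNm measurable_const (hm (q i)).measurable_mk
  have hY : ∀ t, Measurable (Y t) := fun t => by
    obtain ⟨u, hu, hut⟩ := mem_closure_iff_seq_limit.1 (hq t)
    refine measurable_of_tendsto_metrizable (f := fun n => Y (u n)) (fun n => ?_) ?_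
    · obtain ⟨i, hi⟩ := hu n
      rw [← hi]; exact hYq i
    · exact tendsto_pi_nhds.2 fun ω => ((hYc ω).tendsto t).comp hut
  refine ⟨Y, measurable_uncurry_of_continuous_of_measurable hYc hY, ?_⟩
  filter_upwards [measure_eq_zero_iff_ae_notMem.1 hN0] with ω hω t
  simp [Y, hω]

lemma IsFractionalBrownianMotion.exists_hasFBMPairLaw [IsProbabilityMeasure P] (hH0 : 0 < H)
    (hH1 : H < 1) (hB : IsFractionalBrownianMotion H B P) :
    ∃ X : ℝ → Ω → ℝ, HasFBMPairLaw H X P ∧ ∀ᵐ ω ∂P, ∀ s : ℝ, B s.toNNReal ω = X s ω := by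
  obtain ⟨Y, hY, hYB⟩ := exists_measurable_indistinguishable
    (fun t => hB.isGaussianProcess.aemeasurable t) hB.continuous_paths
  refine ⟨fun s => Y s.toNNReal, ⟨?_, ?_⟩, ?_⟩
  · exact hY.comp (measurable_real_toNNReal.prodMap measurable_id)
  · intro p h1 h2 h12
    have e : (fun ω => (Y p.1.toNNReal ω, Y p.2.toNNReal ω)) =ᵐ[P]
        fun ω => (B p.1.toNNReal ω, B p.2.toNNReal ω) := by
      filter_upwards [hYB] with ω hω
      simp [hω]
    have hvar : ∀ s : ℝ, 0 < s → ∫ ω, B s.toNNReal ω * B s.toNNReal ω ∂P = s ^ (2 * H) := by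
      intro s hs
      rw [hB.covariance_eq, Real.coe_toNNReal _ hs.le, sub_self, abs_zero,
        Real.zero_rpow (by positivity)]
      ring
    rw [Measure.map_congr e]
    refine map_pair_eq_withDensity hB.isGaussianProcess.hasGaussianLaw_prodMk
      (hB.integral_eq_zero _) (hB.integral_eq_zero _) (hvar _ h1) ?_ (hvar _ h2) (by positivity)
      (fbmDet_pos hH0 hH1 h1 h2 h12)
    rw [hB.covariance_eq, Real.coe_toNNReal _ h1.le, Real.coe_toNNReal _ h2.le, fbmCov]
  · filter_upwards [hYB] with ω hω s using hω _

end Modification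

theorem theorem1p4 {Ω : Type*} [MeasurableSpace Ω] (P : Measure Ω) [IsProbabilityMeasure P]
    (H : ℝ) (hH0 : 0 < H) (hH : H < 1 / 3)
    (B : ℝ≥0 → Ω → ℝ) (hB : IsFractionalBrownianMotion H B P)
    (f : ℝ → ℝ) (hf : Measurable f) (ν : ℝ) (hν : 0 < ν)
    (hfν : Integrable (fun y : ℝ => |f y| * (1 + |y| ^ (1 + ν))))
    (t : ℝ) (ht : 0 < t) (lam : ℝ) :
    (∃ L : Ω → ℝ, IsLocalTime B P t lam L) ∧
    (∃ L' : Ω → ℝ, IsLocalTimeDeriv B P t lam L') ∧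
    (∀ n : ℕ, ∀ᵐ ω ∂P, IntervalIntegrable
      (fun s : ℝ => f ((n : ℝ) ^ H * (B s.toNNReal ω - lam))) volume 0 t) ∧
    ∀ L L' : Ω → ℝ, IsLocalTime B P t lam L → IsLocalTimeDeriv B P t lam L' →
      TendstoInL2 P
        (fun (n : ℕ) (ω : Ω) => (n : ℝ) ^ H *
          ((n : ℝ) ^ H * (∫ s in (0 : ℝ)..t, f ((n : ℝ) ^ H * (B s.toNNReal ω - lam)))
            - L ω * ∫ y : ℝ, f y))
        atTop
        (fun ω => L' ω * ∫ y : ℝ, y * f y) := by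
  obtain ⟨X, hX, hXB⟩ := hB.exists_hasFBMPairLaw hH0 (by linarith)
  have hfi : Integrable f := by
    refine hfν.mono hf.aestronglyMeasurable (Eventually.of_forall fun y => ?_)
    have : 0 ≤ |y| ^ (1 + ν) := by positivity
    rw [norm_mul, Real.norm_eq_abs, Real.norm_eq_abs, abs_abs, Real.norm_of_nonneg (by positivity)]
    exact le_mul_of_one_le_right (abs_nonneg _) (by linarith)
  have hf1 : Integrable (fun y => y * f y) := by
    refine hfν.mono (by fun_prop) (Eventually.of_forall fun y => ?_)
    have h0 : 0 ≤ |y| ^ (1 + ν) := by positivity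
    rw [norm_mul, norm_mul, Real.norm_eq_abs, Real.norm_eq_abs, Real.norm_eq_abs, abs_abs,
      Real.norm_of_nonneg (by positivity), mul_comm]
    refine mul_le_mul_of_nonneg_left ?_ (abs_nonneg _)
    -- `|y| ≤ 1 + |y| ^ (1 + ν)`
    rcases le_total |y| 1 with h | h
    · linarith
    · have := Real.rpow_le_rpow_of_exponent_le h (by linarith : (1 : ℝ) ≤ 1 + ν)
      rw [Real.rpow_one] at this
      linarith
  -- All functionals of `B` agree almost surely with those of the measurable version `X`.
  have hint : ∀ g : ℝ → ℝ, (fun ω => ∫ s in (0 : ℝ)..t, g (B s.toNNReal ω)) =ᵐ[P]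
      additiveFunctional X t g := fun g => by
    filter_upwards [hXB] with ω hω
    simp only [hω, intervalIntegral.integral_of_le ht.le, additiveFunctional]
  have hloc : ∀ ε, approxLocalTime B t lam ε =ᵐ[P]
      additiveFunctional X t (fun x => heatKernel ε (x - lam)) := fun ε =>
    hint fun x => heatKernel ε (x - lam)
  have hderiv : ∀ ε, 0 < ε → approxLocalTimeDeriv B t lam ε =ᵐ[P]
      additiveFunctional X t (fun x => -heatKernelDeriv ε (x - lam)) := fun ε hε => by
    have : ∀ b, deriv (fun x => heatKernel ε (b - x)) lam = -heatKernelDeriv ε (b - lam) :=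
      fun b => ((hasDerivAt_heatKernel hε (b - lam)).comp_const_sub b lam).deriv
    refine EventuallyEq.trans (Eventually.of_forall fun ω => ?_)
      (hint fun x => -heatKernelDeriv ε (x - lam))
    simp only [approxLocalTimeDeriv, this]
  have hpos : ∀ᶠ ε : ℝ in 𝓝[>] 0, 0 < ε := eventually_mem_nhdsWithin
  have hlocX : ∀ L, IsLocalTime B P t lam L ↔ TendstoInL2 P
      (fun ε => additiveFunctional X t (fun x => heatKernel ε (x - lam))) (𝓝[>] 0) L := fun L =>
    ⟨fun h => h.congr (Eventually.of_forall hloc),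
      fun h => h.congr (Eventually.of_forall fun ε => (hloc ε).symm)⟩
  have hderivX : ∀ L', IsLocalTimeDeriv B P t lam L' ↔ TendstoInL2 P
      (fun ε => additiveFunctional X t (fun x => -heatKernelDeriv ε (x - lam))) (𝓝[>] 0) L' :=
    fun L' => ⟨fun h => h.congr (hpos.mono hderiv),
      fun h => h.congr (hpos.mono fun ε hε => (hderiv ε hε).symm)⟩
  refine ⟨?_, ?_, ?_, ?_⟩
  · obtain ⟨L, hL⟩ := hX.exists_localTime hH0 hH ht lam
    exact ⟨L, (hlocX L).2 hL⟩
  · obtain ⟨L', hL'⟩ := hX.exists_localTimeDeriv hH0 hH ht lam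
    exact ⟨L', (hderivX L').2 hL'⟩
  · intro n
    rcases Nat.eq_zero_or_pos n with rfl | hn
    · refine Eventually.of_forall fun ω => ?_
      simp only [Nat.cast_zero, Real.zero_rpow hH0.ne', zero_mul]
      exact intervalIntegrable_const
    · have hm : 0 < (n : ℝ) ^ H := by positivity
      have := hX.ae_integrableOn hH0 hH ht (g := fun x => f ((n : ℝ) ^ H * (x - lam)))
        (hf.comp (by fun_prop)) (integrable_scale hm lam hfi)
      filter_upwards [this, hXB] with ω hω hB
      rw [intervalIntegrable_iff_integrableOn_Ioc_of_le ht.le]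
      simpa only [hB] using hω
  · intro L L' hL hL'
    rw [hlocX] at hL
    rw [hderivX] at hL'
    -- The index is shifted by one because the scale `n ^ H` vanishes at `n = 0`.
    have hm0 : ∀ n : ℕ, 0 < ((n + 1 : ℕ) : ℝ) ^ H := fun n => by positivity
    have hmt : Tendsto (fun n : ℕ => ((n + 1 : ℕ) : ℝ) ^ H) atTop atTop :=
      (tendsto_rpow_atTop hH0).comp (tendsto_natCast_atTop_atTop.comp (tendsto_add_atTop_nat 1))
    have hlim := hX.tendsto_eLpNorm_sub hH0 hH ht hf hfi hf1 hL hL' hm0 hmt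
    rw [tendsto_add_atTop_iff_nat (f := fun n : ℕ => eLpNorm (fun ω => (n : ℝ) ^ H *
      ((n : ℝ) ^ H * additiveFunctional X t (fun x => f ((n : ℝ) ^ H * (x - lam))) ω
        - L ω * ∫ y, f y) - L' ω * ∫ y, y * f y) 2 P) 1] at hlim
    have hX' : TendstoInL2 P (fun (n : ℕ) ω => (n : ℝ) ^ H *
        ((n : ℝ) ^ H * additiveFunctional X t (fun x => f ((n : ℝ) ^ H * (x - lam))) ω
          - L ω * ∫ y, f y)) atTop (fun ω => L' ω * ∫ y, y * f y) := by
      refine ⟨?_, hL'.2.1.mul_const _, hlim⟩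
      filter_upwards [eventually_gt_atTop 0] with n hn
      have hm : 0 < (n : ℝ) ^ H := by positivity
      have := hX.memLp_additiveFunctional hH0 hH ht (g := fun x => f ((n : ℝ) ^ H * (x - lam)))
        (hf.comp (by fun_prop)) (integrable_scale hm lam hfi)
      exact ((this.const_mul _).sub (hL.2.1.mul_const _)).const_mul _
    refine hX'.congr (Eventually.of_forall fun n => ?_)
    filter_upwards [hint fun x => f ((n : ℝ) ^ H * (x - lam))] with ω hω
    rw [hω]
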